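/- **Setting.** Let $n\ge 0$, $m\ge 1$, let $\lambda\ge 0$, let $h:\mathbb R\to\mathbb R$ be strictly convex, $c(x,y)=h(x-y)$, and let $x_1\le\dots\le x_n$, $y_1\le\dots\le y_m$ be real numbers. The (empirical, one-dimensional) optimal partial transport problem is $$\min_{\gamma\in\Gamma_\le}\ \sum_{i,j}c(x_i,y_j)\gamma_{ij}+\lambda\Big(n+m-2\sum_{i,j}\gamma_{ij}\Big),\qquad \Gamma_\le=\{\gamma\in\mathbb R_+^{n\times m}:\gamma 1_m\le 1_n,\ \gamma^T1_n\le 1_m\}.$$ A plan is a map $L:[1:n]\to\{-1\}\cup[1:m]$ ($L_i=-1$: $x_i$ is destroyed, otherwise $x_i$ is assigned to $y_{L_i}$). It is admissible if it is strictly increasing on $\mathrm{dom}(L)=\{i:L_i\ne-1\}$. Its cost is $C(L)=\sum_{i\in\mathrm{dom}(L)}c(x_i,y_{L_i})+\lambda(n+m-2|\mathrm{dom}(L)|)$, and its matrix is $\gamma^L_{ij}=1$ if $L_i=j$, and $0$ otherwise. $L$ is optimal if it is admissible, minimises $C$ among the admissible plans, and $\gamma^L\in\Gamma_\le$ solves the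 problem above. The dual problem is $$\max\Big\{\sum_{i=1}^n\min\{\Phi_i,\lambda\}+\sum_{j=1}^m\min\{\Psi_j,\lambda\}\ :\ \Phi\in\mathbb R^n,\ \Psi\in\mathbb R^m,\ \Phi_i+\Psi_j\le c(x_i,y_j)\ \forall i,j\Big\}.$$ **Algorithm 1 (opt-1d).** Initialise $\Phi_i\gets-\infty$, $\Psi_j\gets\lambda$, $L_i\gets-1$ for all $i,j$. For $k=1,\dots,n$: let $j^*\in\operatorname{argmin}_{j\in[1:m]}c(x_k,y_j)-\Psi_j$ and $\Phi_k\gets\min\{c(x_k,y_{j^*})-\Psi_{j^*},\lambda\}$. If $\Phi_k=\lambda$ (Case 1), leave $L$ unchanged. Otherwise, if $j^*$ is unassigned (Case 2), set $L_k\gets j^*$. Otherwise (Case 3), run Algorithm 2. Return $L,\Phi,\Psi$. **Algorithm 2 (sub-opt).** Set $i_{\min}\gets k-1$, $j_{\min}\gets j^*$, and repeat: let $i_\Delta\in\operatorname{argmin}_{i\in[i_{\min}:k]}(\lambda-\Phi_i)$, $\lambda_\Delta=\lambda-\Phi_{i_\Delta}$, $\alpha=c(x_k,y_{j^*+1})-\Phi_k-\Psi_{j^*+1}$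 ($+\infty$ if $j^*=m$), $\beta=c(x_{i_{\min}},y_{j_{\min}-1})-\Phi_{i_{\min}}-\Psi_{j_{\min}-1}$ ($+\infty$ if $j_{\min}=1$). Below, "raise by $\Delta$" means $\Phi_i\gets\Phi_i+\Delta$ for $i\in[i_{\min}:k]$ and $\Psi_j\gets\Psi_j-\Delta$ for $j\in[j_{\min}:j^*]$. * Case 3.1, $\lambda_\Delta\le\min\{\alpha,\beta\}$: raise by $\lambda_\Delta$. If $i_\Delta\ne k$, set $L_{i_\Delta}\gets-1$, $L_k\gets j^*$, and $L_i\gets L_i-1$ for $i\in[i_\Delta+1:k-1]$ (if $i_\Delta=k$, then $x_k$ remains unassigned and $L$ is unchanged). Return. * Case 3.2, otherwise, $\alpha\le\min\{\lambda_\Delta,\beta\}$: raise by $\alpha$, set $L_k\gets j^*+1$, return. * Case 3.3, otherwise: raise by $\beta$. (3.3a) If $j_{\min}-1$ is unassigned, set $L_{i_{\min}}\gets j_{\min}-1$, $L_k\gets j^*$, $L_i\gets L_i-1$ for $i\in[i_{\min}+1:k-1]$, and return. (3.3b) Otherwise set $i_{\min}\gets i_{\min}-1$, $j_{\min}\gets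 j_{\min}-1$, and repeat. **Handling of duplicates** (optional in Algorithms 1 and 2): (i) $j^*$ is chosen only among the indices $j$ that are not smaller than any assigned index; (ii) at the beginning of Case 3, if $x_i$ is the point assigned to $y_{j^*}$ and $i<k-1$, then, instead of running Algorithm 2, set $L_i\gets-1$, $L_k\gets j^*$; (iii) in Case 3.3b, if $x_i$ is the point assigned to $y_{j_{\min}-1}$ and $i<i_{\min}-1$, set $L_i\gets-1$ and proceed as in Case 3.3a. **Refined version (Algorithms 4 and 5).** This is the algorithm with handling of duplicates, in which: the inverse array of $L$ is stored and updated together with $L$; the last assigned target index $j_{\rm last}$ is stored (initially $1$; set to $j^*$ in Case 2 and to $j^*+1$ in Case 3.2), and $j^*$ is chosen in $\operatorname{argmin}_{j\in[j_{\rm last}:m]}$; within the sub-routine the dual variables are updated only once, on return: it keeps the total increment $v$ (initially $0$; increased by $\lambda_\Delta$, $\alpha$, $\beta$ in Cases 3.1, 3.2, 3.3), an array $d\in\mathbb R^n$ (initially $0$; in Case 3.3b, $d_{i_{\min}-1}\gets v$), and on return, before $L$ is changed, sets $\Phi_i\gets\Phi_i+v-d_i$, $\Psi_{L_i}\gets\Psi_{L_i}-v+d_i$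 for $i\in[i_{\min}:k-1]$ and $\Phi_k\gets\Phi_k+v$; it uses $\alpha=c(x_k,y_{j^*+1})-\Phi_k-v-\Psi_{j^*+1}$; and $(i_\Delta,\lambda_\Delta)$ is computed at the start from $i\in\{k-1,k\}$ and then maintained: in Case 3.3b, $\lambda_\Delta\gets\lambda_\Delta-\beta$, $i_{\min}\gets i_{\min}-1$, $j_{\min}\gets j_{\min}-1$ and, if $\lambda-\Phi_{i_{\min}}<\lambda_\Delta$, then $\lambda_\Delta\gets\lambda-\Phi_{i_{\min}}$, $i_\Delta\gets i_{\min}$. Running time is counted in steps on a machine with exact real arithmetic: one step for each executed elementary statement (boundedly many arithmetic operations, comparisons, evaluations of $h$ and array accesses), each pass through a loop, each candidate of an argmin, and each initialised array entry. **Theorem.** For every rule of choosing among several minimisers in the argmins: 1. Algorithm 1 (with sub-routine Algorithm 2) is well-defined and correct, without the handling of duplicates if $x_1<\dots<x_n$ and $y_1<\dots<y_m$, and with the handling of duplicates for all sorted lists $x_1\le\dots\le x_n$, $y_1\le\dots\le y_m$: it terminates, never performs an undefined operation (an argmin over an empty set, an index out of range, or $L_i\gets L_i-1$ for an unassigned $x_i$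 or for $L_i=1$), and returns an optimal plan $L$ and finite dual variables $(\Phi,\Psi)$ that solve the dual problem. 2. For all sorted lists, the refined version is well-defined and returns an optimal plan $L$ and an optimal dual solution $(\Phi,\Psi)$ in the same sense, and its worst-case running time is $O(n\max\{m,n\})$: there is an absolute constant $K$ such that for all $n\ge1$, $m\ge 1$ and all inputs as above it takes at most $K\,n\max\{m,n\}$ steps. -/

import Mathlib

namespace OPT1D

noncomputable section

/-! ### The empirical optimal partial transport problem

`c i j` is the cost of the pair `(i, j)`; `lam` is the price of destroying or creating a unit mass. -/

/-- The set `Γ_≤` of nonnegative matrices whose row sums and column sums are at most one. -/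
def SubCouplings (n m : ℕ) : Set (Matrix (Fin n) (Fin m) ℝ) :=
  {γ | (∀ i j, 0 ≤ γ i j) ∧ (∀ i, ∑ j, γ i j ≤ 1) ∧ ∀ j, ∑ i, γ i j ≤ 1}

/-- The primal objective `∑ c γ + lam (n + m - 2 ∑ γ)`. -/
def couplingCost {n m : ℕ} (c : Fin n → Fin m → ℝ) (lam : ℝ) (γ : Matrix (Fin n) (Fin m) ℝ) : ℝ :=
  (∑ i, ∑ j, c i j * γ i j) + lam * (n + m - 2 * ∑ i, ∑ j, γ i j)

/-- The set of source points that a plan transports; `none` marks a destroyed point. -/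
def planDom {n m : ℕ} (L : Fin n → Option (Fin m)) : Finset (Fin n) :=
  Finset.univ.filter fun i => (L i).isSome = true

/-- A plan is admissible if it is strictly increasing on its domain. -/
def IsAdmissible {n m : ℕ} (L : Fin n → Option (Fin m)) : Prop :=
  ∀ i i' j j', i < i' → L i = some j → L i' = some j' → j < j'

/-- `C(L) = ∑_{i ∈ dom L} c i (L i) + lam (n + m - 2 |dom L|)`. -/
def planCost {n m : ℕ} (c : Fin n → Fin m → ℝ) (lam : ℝ) (L : Fin n → Option (Fin m)) : ℝ :=
  (∑ i, (L i).elim 0 (c i)) + lam * (n + m - 2 * (planDom L).card)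

/-- The 0-1 matrix of a plan. -/
def planMatrix {n m : ℕ} (L : Fin n → Option (Fin m)) : Matrix (Fin n) (Fin m) ℝ :=
  fun i j => if L i = some j then 1 else 0

/-- `L` is admissible, minimises `C` among admissible plans, and its matrix solves the primal
problem over `Γ_≤`. -/
def IsOptimalPlan {n m : ℕ} (c : Fin n → Fin m → ℝ) (lam : ℝ) (L : Fin n → Option (Fin m)) :
    Prop :=
  IsAdmissible L ∧ (∀ L', IsAdmissible L' → planCost c lam L ≤ planCost c lam L') ∧
    planMatrix L ∈ SubCouplings n m ∧
    ∀ γ ∈ SubCouplings n m, couplingCost c lam (planMatrix L) ≤ couplingCost c lam γ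

/-- The dual constraints `Φ_i + Ψ_j ≤ c i j`. -/
def DualFeasible {n m : ℕ} (c : Fin n → Fin m → ℝ) (φ : Fin n → ℝ) (ψ : Fin m → ℝ) : Prop :=
  ∀ i j, φ i + ψ j ≤ c i j

/-- The dual objective `∑ min(Φ_i, lam) + ∑ min(Ψ_j, lam)`. -/
def dualValue {n m : ℕ} (lam : ℝ) (φ : Fin n → ℝ) (ψ : Fin m → ℝ) : ℝ :=
  (∑ i, min (φ i) lam) + ∑ j, min (ψ j) lam

/-- `(φ, ψ)` solves the dual problem. -/
def IsOptimalDual {n m : ℕ} (c : Fin n → Fin m → ℝ) (lam : ℝ) (φ : Fin n → ℝ) (ψ : Fin m → ℝ) :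
    Prop :=
  DualFeasible c φ ψ ∧
    ∀ φ' ψ', DualFeasible c φ' ψ' → dualValue lam φ' ψ' ≤ dualValue lam φ ψ

/-! ### Programs: computations that may fail or diverge, with a step counter

A computation takes the number of steps executed so far and returns a value with the new number of
steps, or `none` if it performs an undefined operation or does not terminate. One step is charged
for every executed elementary statement (a bounded number of real arithmetic operations,
comparisons, evaluations of the cost, and array accesses), for every pass through a loop, for every
candidate of an `argmin`, and for every entry of an array that is initialised. -/

/-- Step-counting partial computations. -/
abbrev Exec (α : Type) : Type := StateT ℕ Option α

/-- Charge `t` steps. -/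
def tick (t : ℕ) : Exec Unit := fun s => some ((), s + t)

/-- An undefined operation. -/
def undef {α : Type} : Exec α := fun _ => none

/-- Use a value that must be present. -/
def need {α : Type} (o : Option α) : Exec α := o.elim undef pure

/-- At most `N` passes of `while true: body`, where `body` returns by `Sum.inr`. -/
def loopN {σ ρ : Type} (body : σ → Exec (σ ⊕ ρ)) : ℕ → σ → Exec ρ
  | 0, _ => undef
  | N + 1, s => do
    match ← body s with
    | .inl s' => loopN body N s'
    | .inr r => pure r

open Classical in
/-- `while true: body`. It has a value exactly if `body` returns after finitely many passes without
an undefined operation (the result does not depend on the bound on the number of passes, as soon as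
there is one). -/
def loop {σ ρ : Type} (body : σ → Exec (σ ⊕ ρ)) (s : σ) : Exec ρ := fun t =>
  if h : ∃ N, (loopN body N s t).isSome = true then loopN body (Nat.find h) s t else none

/-- The preceding index, if there is one. -/
def prev? {N : ℕ} (i : Fin N) : Option (Fin N) :=
  if 0 < i.val then some ⟨i.val - 1, by omega⟩ else none

/-- The following index, if there is one. -/
def next? {N : ℕ} (i : Fin N) : Option (Fin N) :=
  if h : i.val + 1 < N then some ⟨i.val + 1, h⟩ else none

/-- The increasing list of the indices strictly between `a` and `b`. -/
def between {N : ℕ} (a b : Fin N) : List (Fin N) :=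
  (List.finRange N).filter fun i => decide (a < i ∧ i < b)

/-- The increasing list of the indices `i` with `a ≤ i < b`. -/
def fromTo {N : ℕ} (a b : Fin N) : List (Fin N) :=
  (List.finRange N).filter fun i => decide (a ≤ i ∧ i < b)

/-- A tie-breaking rule for `argmin`: it picks some minimiser on each nonempty finite set. -/
structure ArgminRule where
  pick : {N : ℕ} → (S : Finset (Fin N)) → S.Nonempty → (Fin N → EReal) → Fin N
  pick_mem : ∀ {N : ℕ} (S : Finset (Fin N)) (hS : S.Nonempty) (f : Fin N → EReal),
    pick S hS f ∈ S
  pick_le : ∀ {N : ℕ} (S : Finset (Fin N)) (hS : S.Nonempty) (f : Fin N → EReal),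
    ∀ i ∈ S, f (pick S hS f) ≤ f i

/-- `argmin_{i ∈ S} f i`, undefined if `S` is empty; one step for each candidate. -/
def argmin (A : ArgminRule) {N : ℕ} (S : Finset (Fin N)) (f : Fin N → EReal) : Exec (Fin N) := do
  tick S.card
  if hS : S.Nonempty then pure (A.pick S hS f) else undef

/-! ### The primal-dual algorithm and its conflict-resolution sub-routine -/

/-- The variables `L`, `Φ`, `Ψ`. -/
structure Vars (n m : ℕ) where
  L : Fin n → Option (Fin m)
  Φ : Fin n → EReal
  Ψ : Fin m → EReal

/-- The index that is assigned to `j`, if there is one. -/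
def assignee {n m : ℕ} (L : Fin n → Option (Fin m)) (j : Fin m) : Option (Fin n) :=
  (List.finRange n).find? fun i => decide (L i = some j)

/-- `for i ∈ is: L_i ← L_i - 1`. -/
def shiftDown {n m : ℕ} (is : List (Fin n)) (L : Fin n → Option (Fin m)) :
    Exec (Fin n → Option (Fin m)) :=
  is.foldlM (fun L i => do
    tick 1
    let j ← need (L i)
    let j' ← need (prev? j)
    pure (Function.update L i (some j'))) L

/-- Increase `Φ` on `[a : k]` and decrease `Ψ` on `[b : j]` by `Δ`. -/
def raise {n m : ℕ} (a k : Fin n) (b j : Fin m) (Δ : EReal) (s : Vars n m) : Vars n m :=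
  { L := s.L
    Φ := fun i => if a ≤ i ∧ i ≤ k then s.Φ i + Δ else s.Φ i
    Ψ := fun l => if b ≤ l ∧ l ≤ j then s.Ψ l - Δ else s.Ψ l }

/-- One pass of the main loop of the sub-routine, in the state `(i_min, j_min, (L, Φ, Ψ))`, for the
conflict of the `k`-th source point over the target point `jstar`. If `dup` is set, duplicate points
are handled. -/
def subOptBody (A : ArgminRule) (dup : Bool) {n m : ℕ} (c : ℝ → ℝ → ℝ) (x : Fin n → ℝ)
    (y : Fin m → ℝ) (lam : ℝ) (k : Fin n) (jstar : Fin m) (st : Fin n × Fin m × Vars n m) :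
    Exec ((Fin n × Fin m × Vars n m) ⊕ Vars n m) := do
  let imin := st.1
  let jmin := st.2.1
  let s := st.2.2
  let iΔ ← argmin A (Finset.Icc imin k) fun i => (lam : EReal) - s.Φ i
  let lamΔ : EReal := (lam : EReal) - s.Φ iΔ
  let α : EReal := (next? jstar).elim ⊤ fun j => (c (x k) (y j) : EReal) - s.Φ k - s.Ψ j
  let β : EReal := (prev? jmin).elim ⊤ fun j => (c (x imin) (y j) : EReal) - s.Φ imin - s.Ψ j
  tick 3
  if lamΔ ≤ min α β then
    -- Case 3.1
    let s := raise imin k jmin jstar lamΔ s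
    tick (k.val + 1 - imin.val + (jstar.val + 1 - jmin.val))
    if iΔ = k then
      pure (.inr s)
    else
      let L := Function.update (Function.update s.L iΔ none) k (some jstar)
      tick 2
      let L ← shiftDown (between iΔ k) L
      pure (.inr { s with L := L })
  else if α ≤ min lamΔ β then
    -- Case 3.2
    let s := raise imin k jmin jstar α s
    tick (k.val + 1 - imin.val + (jstar.val + 1 - jmin.val))
    let j ← need (next? jstar)
    tick 1
    pure (.inr { s with L := Function.update s.L k (some j) })
  else
    let s := raise imin k jmin jstar β s
    tick (k.val + 1 - imin.val + (jstar.val + 1 - jmin.val))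
    let j ← need (prev? jmin)
    tick n
    match assignee s.L j with
    | none =>
      -- Case 3.3a
      let L := Function.update (Function.update s.L imin (some j)) k (some jstar)
      tick 2
      let L ← shiftDown (between imin k) L
      pure (.inr { s with L := L })
    | some i =>
      if dup = true ∧ i.val + 1 < imin.val then
        -- duplicates of the `i`-th source point: unassign it and proceed as in Case 3.3a
        let L := Function.update s.L i none
        let L := Function.update (Function.update L imin (some j)) k (some jstar)
        tick 3
        let L ← shiftDown (between imin k) L
        pure (.inr { s with L := L })
      else
        -- Case 3.3b
        let i' ← need (prev? imin)
        tick 2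
        pure (.inl (i', j, s))

/-- The sub-routine: it starts from `i_min = k - 1` and `j_min = jstar`. -/
def subOpt (A : ArgminRule) (dup : Bool) {n m : ℕ} (c : ℝ → ℝ → ℝ) (x : Fin n → ℝ)
    (y : Fin m → ℝ) (lam : ℝ) (k : Fin n) (jstar : Fin m) (s : Vars n m) : Exec (Vars n m) := do
  let imin ← need (prev? k)
  tick 2
  loop (subOptBody A dup c x y lam k jstar) (imin, jstar, s)

/-- The iteration of the main loop for the `k`-th source point. With `dup` set, the minimisation is
over the indices from the last assigned one on, and a conflict with a point other than the
`(k-1)`-st is resolved by re-assigning. -/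
def opt1dStep (A : ArgminRule) (dup : Bool) {n m : ℕ} (c : ℝ → ℝ → ℝ) (x : Fin n → ℝ)
    (y : Fin m → ℝ) (lam : ℝ) (s : Vars n m) (k : Fin n) : Exec (Vars n m) := do
  let S : Finset (Fin m) :=
    Finset.univ.filter fun j => dup = true → ∀ i j', s.L i = some j' → j' ≤ j
  let jstar ← argmin A S fun j => (c (x k) (y j) : EReal) - s.Ψ j
  let Φk : EReal := min ((c (x k) (y jstar) : EReal) - s.Ψ jstar) lam
  let s : Vars n m := { s with Φ := Function.update s.Φ k Φk }
  tick 2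
  if Φk = lam then
    -- Case 1
    pure s
  else
    tick n
    match assignee s.L jstar with
    | none =>
      -- Case 2
      tick 1
      pure { s with L := Function.update s.L k (some jstar) }
    | some i =>
      -- Case 3
      if dup = true ∧ i.val + 1 < k.val then
        tick 2
        pure { s with L := Function.update (Function.update s.L i none) k (some jstar) }
      else
        subOpt A dup c x y lam k jstar s

/-- The primal-dual algorithm for one-dimensional optimal partial transport. -/
def opt1d (A : ArgminRule) (dup : Bool) {n m : ℕ} (c : ℝ → ℝ → ℝ) (x : Fin n → ℝ)
    (y : Fin m → ℝ) (lam : ℝ) : Exec (Vars n m) := do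
  tick (2 * n + m)
  (List.finRange n).foldlM (opt1dStep A dup c x y lam)
    { L := fun _ => none, Φ := fun _ => ⊥, Ψ := fun _ => lam }

/-! ### The refined version with quadratic running time -/

/-- The variables of the refined version: `R` is the inverse array of `L`, and `jlast` is the last
assigned target point (initially the first index). -/
structure FullVars (n m : ℕ) where
  L : Fin n → Option (Fin m)
  R : Fin m → Option (Fin n)
  Φ : Fin n → EReal
  Ψ : Fin m → EReal
  jlast : Fin m

/-- `L_i ← j`, with the update of the inverse array. -/
def assign {n m : ℕ} (i : Fin n) (j : Fin m) (s : FullVars n m) : Exec (FullVars n m) := do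
  tick 2
  pure { s with L := Function.update s.L i (some j), R := Function.update s.R j (some i) }

/-- `L_i ← -1`. It is used only where the former target point of `i` is assigned anew in the same
iteration, so that the inverse array needs no update here. -/
def unassign {n m : ℕ} (i : Fin n) (s : FullVars n m) : Exec (FullVars n m) := do
  tick 1
  pure { s with L := Function.update s.L i none }

/-- `for i ∈ is: L_i ← L_i - 1`. -/
def shiftDownFull {n m : ℕ} (is : List (Fin n)) (s : FullVars n m) : Exec (FullVars n m) :=
  is.foldlM (fun s i => do
    tick 1
    let j ← need (s.L i)
    let j' ← need (prev? j)
    assign i j' s) s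

/-- The delayed update of the dual variables: `Φ_i ← Φ_i + v - d_i` and
`Ψ_{L_i} ← Ψ_{L_i} - v + d_i` for `i ∈ [imin : k-1]`, then `Φ_k ← Φ_k + v`. -/
def applyDuals {n m : ℕ} (imin k : Fin n) (v : EReal) (d : Fin n → EReal) (s : FullVars n m) :
    Exec (FullVars n m) := do
  let s ← (fromTo imin k).foldlM (fun (s : FullVars n m) i => do
    tick 3
    let j ← need (s.L i)
    pure { s with
      Φ := Function.update s.Φ i (s.Φ i + (v - d i))
      Ψ := Function.update s.Ψ j (s.Ψ j - (v - d i)) }) s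
  tick 1
  pure { s with Φ := Function.update s.Φ k (s.Φ k + v) }

/-- The local variables of the refined sub-routine. -/
structure ChainVars (n m : ℕ) where
  imin : Fin n
  jmin : Fin m
  v : EReal
  d : Fin n → EReal
  iΔ : Fin n
  lamΔ : EReal

/-- One pass of the main loop of the refined sub-routine; the arrays in `s` are changed only when
it returns. -/
def subOptFullBody {n m : ℕ} (c : ℝ → ℝ → ℝ) (x : Fin n → ℝ) (y : Fin m → ℝ) (lam : ℝ)
    (k : Fin n) (jstar : Fin m) (s : FullVars n m) (w : ChainVars n m) :
    Exec (ChainVars n m ⊕ FullVars n m) := do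
  let α : EReal := (next? jstar).elim ⊤ fun j =>
    (c (x k) (y j) : EReal) - s.Φ k - w.v - s.Ψ j
  let β : EReal := (prev? w.jmin).elim ⊤ fun j =>
    (c (x w.imin) (y j) : EReal) - s.Φ w.imin - s.Ψ j
  tick 4
  if w.lamΔ ≤ min α β then
    -- Case 3.1
    tick 1
    let s ← applyDuals w.imin k (w.v + w.lamΔ) w.d s
    if w.iΔ = k then
      pure (.inr s)
    else
      let s ← unassign w.iΔ s
      let s ← assign k jstar s
      let s ← shiftDownFull (between w.iΔ k) s
      pure (.inr s)
  else if α ≤ min w.lamΔ β then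
    -- Case 3.2
    tick 1
    let s ← applyDuals w.imin k (w.v + α) w.d s
    let j ← need (next? jstar)
    let s ← assign k j s
    tick 1
    pure (.inr { s with jlast := j })
  else
    tick 1
    let v := w.v + β
    let j ← need (prev? w.jmin)
    match s.R j with
    | none =>
      -- Case 3.3a
      let s ← applyDuals w.imin k v w.d s
      let s ← assign w.imin j s
      let s ← assign k jstar s
      let s ← shiftDownFull (between w.imin k) s
      pure (.inr s)
    | some i =>
      if i.val + 1 < w.imin.val then
        -- duplicates of the `i`-th source point: unassign it and proceed as in Case 3.3a
        let s ← applyDuals w.imin k v w.d s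
        let s ← unassign i s
        let s ← assign w.imin j s
        let s ← assign k jstar s
        let s ← shiftDownFull (between w.imin k) s
        pure (.inr s)
      else
        -- Case 3.3b
        let i' ← need (prev? w.imin)
        let d := Function.update w.d i' v
        let lamΔ := w.lamΔ - β
        tick 5
        let gap : EReal := (lam : EReal) - s.Φ i'
        if gap < lamΔ then
          tick 2
          pure (.inl { imin := i', jmin := j, v := v, d := d, iΔ := i', lamΔ := gap })
        else
          pure (.inl { imin := i', jmin := j, v := v, d := d, iΔ := w.iΔ, lamΔ := lamΔ })

/-- The refined sub-routine. -/
def subOptFull (A : ArgminRule) {n m : ℕ} (c : ℝ → ℝ → ℝ) (x : Fin n → ℝ) (y : Fin m → ℝ)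
    (lam : ℝ) (k : Fin n) (jstar : Fin m) (s : FullVars n m) : Exec (FullVars n m) := do
  let imin ← need (prev? k)
  let d : Fin n → EReal := fun _ => 0
  tick (n + 3)
  let iΔ ← argmin A {imin, k} fun i => (lam : EReal) - s.Φ i
  tick 1
  loop (subOptFullBody c x y lam k jstar s)
    { imin := imin, jmin := jstar, v := 0, d := d, iΔ := iΔ, lamΔ := (lam : EReal) - s.Φ iΔ }

/-- The iteration of the main loop of the refined version for the `k`-th source point. -/
def opt1dFullStep (A : ArgminRule) {n m : ℕ} (c : ℝ → ℝ → ℝ) (x : Fin n → ℝ) (y : Fin m → ℝ)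
    (lam : ℝ) (s : FullVars n m) (k : Fin n) : Exec (FullVars n m) := do
  tick 1
  let jstar ← argmin A (Finset.Ici s.jlast) fun j => (c (x k) (y j) : EReal) - s.Ψ j
  let Φk : EReal := min ((c (x k) (y jstar) : EReal) - s.Ψ jstar) lam
  let s : FullVars n m := { s with Φ := Function.update s.Φ k Φk }
  tick 2
  if Φk = lam then
    -- Case 1
    pure s
  else
    tick 1
    match s.R jstar with
    | none =>
      -- Case 2
      let s ← assign k jstar s
      tick 1
      pure { s with jlast := jstar }
    | some i =>
      -- Case 3
      tick 1
      if i.val + 1 < k.val then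
        let s ← unassign i s
        assign k jstar s
      else
        subOptFull A c x y lam k jstar s

/-- The refined primal-dual algorithm for one-dimensional optimal partial transport. -/
def opt1dFull (A : ArgminRule) {n m : ℕ} (c : ℝ → ℝ → ℝ) (x : Fin n → ℝ) (y : Fin m → ℝ)
    (lam : ℝ) : Exec (FullVars n m) := do
  tick (2 * n + 2 * m + 1)
  let j₁ ← need (if h : 0 < m then some (⟨0, h⟩ : Fin m) else none)
  (List.finRange n).foldlM (opt1dFullStep A c x y lam)
    { L := fun _ => none, R := fun _ => none, Φ := fun _ => ⊥, Ψ := fun _ => lam, jlast := j₁ }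

/-- The output `(L, Φ, Ψ)` is optimal: `L` is an optimal plan, all dual variables are finite, and
they form an optimal solution of the dual problem. -/
def IsOptimalOutput {n m : ℕ} (c : ℝ → ℝ → ℝ) (x : Fin n → ℝ) (y : Fin m → ℝ) (lam : ℝ)
    (L : Fin n → Option (Fin m)) (Φ : Fin n → EReal) (Ψ : Fin m → EReal) : Prop :=
  IsOptimalPlan (fun i j => c (x i) (y j)) lam L ∧
    ∃ (φ : Fin n → ℝ) (ψ : Fin m → ℝ), (∀ i, Φ i = (φ i : EReal)) ∧ (∀ j, Ψ j = (ψ j : EReal)) ∧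
      IsOptimalDual (fun i j => c (x i) (y j)) lam φ ψ

end

end OPT1D

/-! Optimality is certified by complementary slackness. Truncating dual variables at `lam` preserves
the dual constraints, so every feasible dual pair bounds the cost of every sub-coupling from below.
An admissible plan and a feasible dual pair that is bounded by `lam`, tight on assigned pairs and
equal to `lam` at unassigned points have the same value, so both are optimal
(`planCost_eq_dualValue`, `isOptimal_of_dualValue_eq`). `Inv` states these conditions for the first
`k` source points and all target points; each iteration has to carry it from `k` to `k + 1`.

Convexity enters only through `SortedCost`. By the Monge inequality an assigned target has at most
the reduced cost of any target before it, so a new point competes only from the last assigned target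
on. In a conflict, the sources `a, …, k - 1` occupy consecutive targets `b, …, js`, and each source
after `a`, up to `k`, is also tight with the target of its predecessor. Raising `φ` on `a, …, k` and
lowering `ψ` on `b, …, js` by the same amount keeps this tightness, and the only new constraints to
watch are the corners `(k, js + 1)` and `(a, b - 1)` (`Chain.raise`). The first event decides: some
`φ` reaches `lam` and its point is left out; or the right corner becomes tight and `k` goes there;
or the left corner becomes tight, and the chain shifts onto a free target or absorbs the owner of `b
- 1`. Tightness with the predecessor's target is what makes a shifted plan tight
(`Chain.finish_shift`).

The owner `i` of `b - 1` should be `a - 1`. Otherwise `a - 1` is unassigned, so its `φ` is `lam`,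
and quasi-convexity in the column of `b - 1` forces `φ i = lam`; then `i` can be dropped at no loss.
For strictly sorted points this is impossible (`SortedCost.eq_of_gap`).

Absorption lowers `a`, so the sub-routine terminates. The refined version makes the same decisions
on stored dual variables with a pending increment (`Delayed`). A repeating pass has constant cost
and a returning one linear cost in `n`, hence an iteration takes `O(m + n)` steps. -/

namespace OPT1D

/-! ### Cost matrices of strictly convex costs on sorted points -/

/-- The Monge property and the convexity properties along rows and columns of the cost matrix of
sorted points; if `dup` is not set, also the strict versions for strictly sorted points. -/
structure SortedCost {n m : ℕ} (C : Fin n → Fin m → ℝ) (dup : Bool) : Prop where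
  monge : ∀ i i' j j', i ≤ i' → j ≤ j' → C i j + C i' j' ≤ C i j' + C i' j
  monge_lt : dup = false → ∀ i i' j j', i < i' → j < j' → C i j + C i' j' < C i j' + C i' j
  row : ∀ i j j' j'', j ≤ j' → j' ≤ j'' → C i j' ≤ max (C i j) (C i j'')
  col : ∀ i i' i'' j a, i ≤ i' → i' ≤ i'' → C i j ≤ a → C i'' j < a → a ≤ C i' j → C i j = a
  col_lt : dup = false → ∀ i i' i'' j a, i < i' → i' ≤ i'' → C i j ≤ a → C i'' j < a →
    C i' j < a

/-- `u` and `w` are convex combinations of `p` and `q` with interchanged weights, so adding the two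
convexity inequalities gives each endpoint value total weight one. -/
theorem convex_exchange {h : ℝ → ℝ} (hh : ConvexOn ℝ Set.univ h) {p u w q : ℝ} (hpu : p ≤ u)
    (huq : u ≤ q) (hs : u + w = p + q) : h u + h w ≤ h p + h q := by
  rcases eq_or_lt_of_le (hpu.trans huq) with hpq | hpq
  · obtain rfl : u = p := by linarith
    obtain rfl : w = u := by linarith
    rw [← hpq]
  · have hd : 0 < q - p := by linarith
    have h1 := hh.2 (Set.mem_univ p) (Set.mem_univ q)
      (div_nonneg (sub_nonneg.2 huq) hd.le) (div_nonneg (sub_nonneg.2 hpu) hd.le)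
      (by field_simp; ring)
    have h2 := hh.2 (Set.mem_univ p) (Set.mem_univ q)
      (div_nonneg (sub_nonneg.2 hpu) hd.le) (div_nonneg (sub_nonneg.2 huq) hd.le)
      (by field_simp; ring)
    have e1 : ((q - u) / (q - p)) • p + ((u - p) / (q - p)) • q = u := by
      simp only [smul_eq_mul]; field_simp; ring
    have e2 : ((u - p) / (q - p)) • p + ((q - u) / (q - p)) • q = w := by
      obtain rfl : w = p + q - u := by linarith
      simp only [smul_eq_mul]; field_simp; ring
    have e3 : (q - u) / (q - p) + (u - p) / (q - p) = 1 := by field_simp; ring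
    rw [e1] at h1
    rw [e2] at h2
    simp only [smul_eq_mul] at h1 h2
    calc h u + h w ≤ ((q - u) / (q - p) + (u - p) / (q - p)) * (h p + h q) := by linarith
      _ = h p + h q := by rw [e3, one_mul]

theorem strictConvex_exchange {h : ℝ → ℝ} (hh : StrictConvexOn ℝ Set.univ h) {p u w q : ℝ}
    (hpu : p < u) (huq : u < q) (hs : u + w = p + q) : h u + h w < h p + h q := by
  have hd : 0 < q - p := by linarith
  have hne : p ≠ q := (hpu.trans huq).ne
  have h1 := hh.2 (Set.mem_univ p) (Set.mem_univ q) hne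
    (div_pos (sub_pos.2 huq) hd) (div_pos (sub_pos.2 hpu) hd) (by field_simp; ring)
  have h2 := hh.2 (Set.mem_univ p) (Set.mem_univ q) hne
    (div_pos (sub_pos.2 hpu) hd) (div_pos (sub_pos.2 huq) hd) (by field_simp; ring)
  have e1 : ((q - u) / (q - p)) • p + ((u - p) / (q - p)) • q = u := by
    simp only [smul_eq_mul]; field_simp; ring
  have e2 : ((u - p) / (q - p)) • p + ((q - u) / (q - p)) • q = w := by
    obtain rfl : w = p + q - u := by linarith
    simp only [smul_eq_mul]; field_simp; ring
  have e3 : (q - u) / (q - p) + (u - p) / (q - p) = 1 := by field_simp; ring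
  rw [e1] at h1
  rw [e2] at h2
  simp only [smul_eq_mul] at h1 h2
  calc h u + h w < ((q - u) / (q - p) + (u - p) / (q - p)) * (h p + h q) := by linarith
    _ = h p + h q := by rw [e3, one_mul]

theorem strictConvex_lt {h : ℝ → ℝ} (hh : StrictConvexOn ℝ Set.univ h) {p u q a : ℝ} (hpu : p < u)
    (huq : u ≤ q) (hp : h p ≤ a) (hq : h q < a) : h u < a := by
  rcases eq_or_lt_of_le huq with rfl | huq
  · exact hq
  · have := hh.lt_on_openSegment (Set.mem_univ p) (Set.mem_univ q) (hpu.trans huq).ne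
      (show u ∈ openSegment ℝ p q by
        rw [openSegment_eq_Ioo (hpu.trans huq)]; exact ⟨hpu, huq⟩)
    exact this.trans_le (max_le hp hq.le)

/-- Among the four differences, `x i - y j'` is the smallest and `x i' - y j` the largest, and the
two diagonals have equal sums: the Monge inequality is the exchange inequality. In `col`, strict
convexity leaves only the possibility `x i = x i'`. -/
theorem sortedCost_of_strictConvexOn {n m : ℕ} {h : ℝ → ℝ} (hh : StrictConvexOn ℝ Set.univ h)
    {x : Fin n → ℝ} {y : Fin m → ℝ} (hx : Monotone x) (hy : Monotone y) {dup : Bool}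
    (hdup : dup = true ∨ (StrictMono x ∧ StrictMono y)) :
    SortedCost (fun i j => h (x i - y j)) dup where
  monge i i' j j' hi hj := by
    have := convex_exchange hh.convexOn (p := x i - y j') (u := x i - y j) (w := x i' - y j')
      (q := x i' - y j) (by linarith [hy hj]) (by linarith [hx hi]) (by ring)
    exact this
  monge_lt hd i i' j j' hi hj := by
    obtain ⟨hx', hy'⟩ := hdup.resolve_left (by simp [hd])
    exact strictConvex_exchange hh (p := x i - y j') (u := x i - y j) (w := x i' - y j')
      (q := x i' - y j) (by linarith [hy' hj]) (by linarith [hx' hi]) (by ring)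
  row i j j' j'' h1 h2 := by
    have := hh.convexOn.le_max_of_mem_Icc (Set.mem_univ (x i - y j'')) (Set.mem_univ (x i - y j))
      (z := x i - y j') ⟨by linarith [hy h2], by linarith [hy h1]⟩
    rwa [max_comm]
  col i i' i'' j a h1 h2 h3 h4 h5 := by
    rcases eq_or_lt_of_le (hx h1) with he | hlt
    · rw [← he] at h5
      exact le_antisymm h3 h5
    · exact absurd h5 (not_le.2 (strictConvex_lt hh (by linarith)
        (by linarith [hx h2] : x i' - y j ≤ x i'' - y j) h3 h4))
  col_lt hd i i' i'' j a h1 h2 h3 h4 := by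
    obtain ⟨hx', -⟩ := hdup.resolve_left (by simp [hd])
    exact strictConvex_lt hh (by linarith [hx' h1])
        (by linarith [hx h2] : x i' - y j ≤ x i'' - y j) h3 h4

/-! ### Weak duality and complementary slackness -/

/-- Weak duality. The truncated variables satisfy the same constraints, and the missing mass of each
row and column is charged `lam`, which dominates the truncated variable. -/
theorem dualValue_le_couplingCost {n m : ℕ} {C : Fin n → Fin m → ℝ} {lam : ℝ}
    {φ : Fin n → ℝ} {ψ : Fin m → ℝ} (hf : DualFeasible C φ ψ) {γ : Matrix (Fin n) (Fin m) ℝ}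
    (hγ : γ ∈ SubCouplings n m) : dualValue lam φ ψ ≤ couplingCost C lam γ := by
  obtain ⟨h0, h1, h2⟩ := hγ
  have key : ∀ i j, (min (φ i) lam + min (ψ j) lam) * γ i j ≤ C i j * γ i j := fun i j =>
    mul_le_mul_of_nonneg_right ((add_le_add (min_le_left _ _) (min_le_left _ _)).trans (hf i j))
      (h0 i j)
  have s1 : ∑ i, ∑ j, (min (φ i) lam + min (ψ j) lam) * γ i j ≤ ∑ i, ∑ j, C i j * γ i j :=
    Finset.sum_le_sum fun i _ => Finset.sum_le_sum fun j _ => key i j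
  have e1 : ∑ i, ∑ j, (min (φ i) lam + min (ψ j) lam) * γ i j
      = ∑ i, min (φ i) lam * ∑ j, γ i j + ∑ j, min (ψ j) lam * ∑ i, γ i j := by
    simp only [add_mul, Finset.sum_add_distrib, Finset.mul_sum]
    congr 1
    exact Finset.sum_comm
  have a1 : ∑ i, min (φ i) lam * (1 - ∑ j, γ i j) ≤ ∑ i, lam * (1 - ∑ j, γ i j) :=
    Finset.sum_le_sum fun i _ =>
      mul_le_mul_of_nonneg_right (min_le_right _ _) (by linarith [h1 i])
  have a2 : ∑ j, min (ψ j) lam * (1 - ∑ i, γ i j) ≤ ∑ j, lam * (1 - ∑ i, γ i j) :=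
    Finset.sum_le_sum fun j _ =>
      mul_le_mul_of_nonneg_right (min_le_right _ _) (by linarith [h2 j])
  have e4 : ∑ j, ∑ i, γ i j = ∑ i, ∑ j, γ i j := Finset.sum_comm
  simp only [mul_sub, mul_one, Finset.sum_sub_distrib, Finset.sum_const, Finset.card_univ,
    Fintype.card_fin, nsmul_eq_mul, ← Finset.mul_sum, e4] at a1 a2
  unfold dualValue couplingCost
  nlinarith

theorem IsAdmissible.injOn {n m : ℕ} {L : Fin n → Option (Fin m)} (hL : IsAdmissible L)
    {i i' : Fin n} {j : Fin m} (h : L i = some j) (h' : L i' = some j) : i = i' := by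
  rcases lt_trichotomy i i' with hlt | he | hlt
  · exact absurd (hL _ _ _ _ hlt h h') (lt_irrefl _)
  · exact he
  · exact absurd (hL _ _ _ _ hlt h' h) (lt_irrefl _)

theorem sum_planMatrix_row {n m : ℕ} (L : Fin n → Option (Fin m)) (i : Fin n) (f : Fin m → ℝ) :
    ∑ j, f j * planMatrix L i j = (L i).elim 0 f := by
  unfold planMatrix
  cases hi : L i with
  | none => simp
  | some j => simp

theorem couplingCost_planMatrix {n m : ℕ} (C : Fin n → Fin m → ℝ) (lam : ℝ)
    (L : Fin n → Option (Fin m)) : couplingCost C lam (planMatrix L) = planCost C lam L := by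
  have h2 : ∑ i, ∑ j, planMatrix L i j = ((planDom L).card : ℝ) := by
    have : ∀ i, ∑ j, planMatrix L i j = if (L i).isSome = true then (1 : ℝ) else 0 := by
      intro i
      have := sum_planMatrix_row L i fun _ => 1
      simp only [one_mul] at this
      rw [this]
      cases L i <;> simp
    simp only [this, planDom, Finset.sum_boole]
  unfold couplingCost planCost
  rw [h2]
  simp only [sum_planMatrix_row]

theorem planMatrix_mem {n m : ℕ} {L : Fin n → Option (Fin m)} (hL : IsAdmissible L) :
    planMatrix L ∈ SubCouplings n m := by
  refine ⟨fun i j => ?_, fun i => ?_, fun j => ?_⟩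
  · unfold planMatrix; split_ifs <;> norm_num
  · have := sum_planMatrix_row L i fun _ => 1
    simp only [one_mul] at this
    rw [this]
    cases L i <;> simp
  · unfold planMatrix
    rw [Finset.sum_boole]
    have : (Finset.univ.filter fun i => L i = some j).card ≤ 1 :=
      Finset.card_le_one.2 fun a ha b hb => hL.injOn (by simpa using ha) (by simpa using hb)
    exact_mod_cast this

theorem isOptimal_of_dualValue_eq {n m : ℕ} {C : Fin n → Fin m → ℝ} {lam : ℝ}
    {L : Fin n → Option (Fin m)} {φ : Fin n → ℝ} {ψ : Fin m → ℝ} (hL : IsAdmissible L)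
    (hf : DualFeasible C φ ψ) (he : planCost C lam L = dualValue lam φ ψ) :
    IsOptimalPlan C lam L ∧ IsOptimalDual C lam φ ψ := by
  refine ⟨⟨hL, fun L' hL' => ?_, planMatrix_mem hL, fun γ hγ => ?_⟩, hf, fun φ' ψ' hf' => ?_⟩
  · rw [he, ← couplingCost_planMatrix]
    exact dualValue_le_couplingCost hf (planMatrix_mem hL')
  · rw [couplingCost_planMatrix, he]
    exact dualValue_le_couplingCost hf hγ
  · rw [← he, ← couplingCost_planMatrix]
    exact dualValue_le_couplingCost hf' (planMatrix_mem hL)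

/-- Each dual variable splits into itself times the transported mass plus `lam` times the missing
mass of its row or column: either no mass is missing, or all of it is and the variable equals `lam`.
Summation gives the primal objective. -/
theorem planCost_eq_dualValue {n m : ℕ} {C : Fin n → Fin m → ℝ} {lam : ℝ}
    {L : Fin n → Option (Fin m)} {φ : Fin n → ℝ} {ψ : Fin m → ℝ} (hL : IsAdmissible L)
    (tight : ∀ i j, L i = some j → φ i + ψ j = C i j) (hφ : ∀ i, φ i ≤ lam) (hψ : ∀ j, ψ j ≤ lam)
    (hφ' : ∀ i, L i = none → φ i = lam) (hψ' : ∀ j, (∀ i, L i ≠ some j) → ψ j = lam) :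
    planCost C lam L = dualValue lam φ ψ := by
  rw [← couplingCost_planMatrix]
  have e1 : ∀ i j, C i j * planMatrix L i j = (φ i + ψ j) * planMatrix L i j := by
    intro i j
    unfold planMatrix
    split_ifs with h
    · rw [tight i j h]
    · simp
  have r : ∀ i, φ i = φ i * (∑ j, planMatrix L i j) + lam * (1 - ∑ j, planMatrix L i j) := by
    intro i
    have := sum_planMatrix_row L i fun _ => 1
    simp only [one_mul] at this
    rw [this]
    cases hi : L i with
    | none => simp [hφ' i hi]
    | some j => simp
  have q : ∀ j, ψ j = ψ j * (∑ i, planMatrix L i j) + lam * (1 - ∑ i, planMatrix L i j) := by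
    intro j
    by_cases hj : ∃ i, L i = some j
    · obtain ⟨i, hi⟩ := hj
      have : ∑ i, planMatrix L i j = 1 := by
        rw [Finset.sum_eq_single i]
        · simp [planMatrix, hi]
        · intro b _ hb
          exact if_neg fun h => hb (hL.injOn h hi)
        · simp
      rw [this]; ring
    · push Not at hj
      have : ∑ i, planMatrix L i j = 0 :=
        Finset.sum_eq_zero fun i _ => if_neg (hj i)
      rw [this, hψ' j hj]; ring
  have hr : ∑ i, φ i = ∑ i, (φ i * (∑ j, planMatrix L i j) + lam * (1 - ∑ j, planMatrix L i j)) :=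
    Finset.sum_congr rfl fun i _ => r i
  have hq : ∑ j, ψ j = ∑ j, (ψ j * (∑ i, planMatrix L i j) + lam * (1 - ∑ i, planMatrix L i j)) :=
    Finset.sum_congr rfl fun j _ => q j
  have e4 : ∑ j, ∑ i, planMatrix L i j = ∑ i, ∑ j, planMatrix L i j := Finset.sum_comm
  have e5 : ∑ j, ψ j * ∑ i, planMatrix L i j = ∑ i, ∑ j, ψ j * planMatrix L i j := by
    simp only [Finset.mul_sum]
    exact Finset.sum_comm
  simp only [Finset.sum_add_distrib, mul_sub, mul_one, Finset.sum_sub_distrib, Finset.sum_const,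
    Finset.card_univ, Fintype.card_fin, nsmul_eq_mul, ← Finset.mul_sum (a := lam), e4, e5] at hr hq
  unfold couplingCost dualValue
  simp only [min_eq_left (hφ _), min_eq_left (hψ _), e1]
  have e6 : ∑ i, φ i * ∑ j, planMatrix L i j = ∑ i, ∑ j, φ i * planMatrix L i j := by
    simp only [Finset.mul_sum]
  rw [hr, hq, e6]
  simp only [add_mul, Finset.sum_add_distrib]
  ring

/-! ### The loop invariants -/

/-- The invariant of the main loop after `k` iterations: primal and dual variables satisfy the
feasibility and complementary slackness conditions of the problem for the first `k` source
points. -/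
structure Inv {n m : ℕ} (C : Fin n → Fin m → ℝ) (lam : ℝ) (k : ℕ) (L : Fin n → Option (Fin m))
    (φ : Fin n → ℝ) (ψ : Fin m → ℝ) : Prop where
  adm : IsAdmissible L
  dom : ∀ i j, L i = some j → i.val < k
  feas : ∀ i j, i.val < k → φ i + ψ j ≤ C i j
  tight : ∀ i j, L i = some j → φ i + ψ j = C i j
  φ_le : ∀ i, i.val < k → φ i ≤ lam
  ψ_le : ∀ j, ψ j ≤ lam
  φ_eq : ∀ i, i.val < k → L i = none → φ i = lam
  ψ_eq : ∀ j, (∀ i, L i ≠ some j) → ψ j = lam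

/-- The invariant of the sub-routine for the conflict of `k` over `js`: the points
`a, …, k - 1` are assigned to the consecutive points `b, …, js`, and each of them, as well as `k`,
is also tight with the target point of its predecessor. -/
structure Chain {n m : ℕ} (C : Fin n → Fin m → ℝ) (lam : ℝ) (k : Fin n) (js : Fin m) (a : Fin n)
    (b : Fin m) (L : Fin n → Option (Fin m)) (φ : Fin n → ℝ) (ψ : Fin m → ℝ) : Prop where
  adm : IsAdmissible L
  dom : ∀ i j, L i = some j → i < k
  feas : ∀ i j, i ≤ k → φ i + ψ j ≤ C i j
  tight : ∀ i j, L i = some j → φ i + ψ j = C i j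
  φ_le : ∀ i, i ≤ k → φ i ≤ lam
  ψ_le : ∀ j, ψ j ≤ lam
  φ_eq : ∀ i, i < k → L i = none → φ i = lam
  ψ_eq : ∀ j, (∀ i, L i ≠ some j) → ψ j = lam
  last : ∀ i j, L i = some j → j ≤ js
  lt : a < k
  block : ∀ i, a ≤ i → i < k → ∃ j, L i = some j ∧ j.val + a.val = b.val + i.val
  size : b.val + k.val = js.val + a.val + 1
  next : ∀ i i' j, a ≤ i → i'.val = i.val + 1 → i' ≤ k → L i = some j → φ i' + ψ j = C i' j

section Invariants

variable {n m : ℕ} {C : Fin n → Fin m → ℝ} {lam : ℝ} {dup : Bool}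
  {L L' : Fin n → Option (Fin m)} {φ : Fin n → ℝ} {ψ : Fin m → ℝ}

/-- Compare column `j` with the level `lam + ψ j`: the end `i` is at most at this level, the end `a`
strictly below it, but the middle point `p` is at or above it. Quasi-convexity permits this only if
`i` lies exactly on the level, and strict sorting excludes it. -/
theorem SortedCost.eq_of_gap (hC : SortedCost C dup) {i p a : Fin n} {j : Fin m} (hip : i < p)
    (hpa : p ≤ a) (ti : φ i + ψ j = C i j) (li : φ i ≤ lam) (ta : φ a + ψ j = C a j)
    (la : φ a < lam) (ep : φ p = lam) (fp : φ p + ψ j ≤ C p j) : φ i = lam ∧ dup = true := by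
  constructor
  · have := hC.col i p a j (lam + ψ j) hip.le hpa (by linarith) (by linarith) (by linarith)
    linarith
  · by_contra hd
    have := hC.col_lt (by simpa using hd) i p a j (lam + ψ j) hip hpa (by linarith) (by linarith)
    linarith

theorem inv_zero : Inv C lam 0 (fun _ => none) φ fun _ => lam where
  adm := by intro i i' j j' _ h; simp at h
  dom := by simp
  feas := by simp
  tight := by simp
  φ_le := by simp
  ψ_le := by simp
  φ_eq := by simp
  ψ_eq := by simp

theorem Inv.isOptimal (h : Inv C lam n L φ ψ) : IsOptimalPlan C lam L ∧ IsOptimalDual C lam φ ψ :=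
  isOptimal_of_dualValue_eq h.adm (fun i j => h.feas i j i.2)
    (planCost_eq_dualValue h.adm h.tight (fun i => h.φ_le i i.2) h.ψ_le
      (fun i => h.φ_eq i i.2) h.ψ_eq)

/-- At stage `k` the invariant involves `φ` only below `k`, so the entry of the incoming point is
still free. -/
theorem Inv.update_dual {k : Fin n} (h : Inv C lam k L φ ψ) (v : ℝ) :
    Inv C lam k L (Function.update φ k v) ψ := by
  have e : ∀ i : Fin n, i.val < k.val → Function.update φ k v i = φ i := fun i hi =>
    Function.update_of_ne (Fin.ne_of_lt hi) _ _
  exact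
  { adm := h.adm
    dom := h.dom
    feas := fun i j hi => by rw [e i hi]; exact h.feas i j hi
    tight := fun i j hi => by rw [e i (h.dom i j hi)]; exact h.tight i j hi
    φ_le := fun i hi => by rw [e i hi]; exact h.φ_le i hi
    ψ_le := h.ψ_le
    φ_eq := fun i hi hn => by rw [e i hi]; exact h.φ_eq i hi hn
    ψ_eq := h.ψ_eq }

/-- The reduced cost at an assigned index is at most the one at each smaller index. -/
theorem Inv.le_reduced {k : Fin n} (hC : SortedCost C dup) (h : Inv C lam k L φ ψ) {i : Fin n}
    {j j' : Fin m} (hL : L i = some j') (hj : j ≤ j') : C k j' - ψ j' ≤ C k j - ψ j := by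
  have hi := h.dom i j' hL
  linarith [hC.monge i k j j' hi.le hj, h.feas i j hi, h.tight i j' hL]

/-- For strictly sorted points this keeps every minimiser from lying before an assigned target, so
the candidates need no explicit restriction. -/
theorem Inv.lt_reduced {k : Fin n} (hC : SortedCost C dup) (hd : dup = false)
    (h : Inv C lam k L φ ψ) {i : Fin n}
    {j j' : Fin m} (hL : L i = some j') (hj : j < j') : C k j' - ψ j' < C k j - ψ j := by
  have hi := h.dom i j' hL
  linarith [hC.monge_lt hd i k j j' hi hj, h.feas i j hi, h.tight i j' hL]

theorem Inv.step_unassigned {k : Fin n} (h : Inv C lam k L φ ψ) (hk : φ k = lam)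
    (hf : ∀ j, φ k + ψ j ≤ C k j) : Inv C lam (k + 1) L φ ψ where
  adm := h.adm
  dom i j hi := (h.dom i j hi).trans (Nat.lt_succ_self _)
  feas i j hi := by
    rcases Nat.lt_succ_iff_lt_or_eq.1 hi with hi | hi
    · exact h.feas i j hi
    · rw [Fin.ext hi]; exact hf j
  tight := h.tight
  φ_le i hi := by
    rcases Nat.lt_succ_iff_lt_or_eq.1 hi with hi | hi
    · exact h.φ_le i hi
    · rw [Fin.ext hi, hk]
  ψ_le := h.ψ_le
  φ_eq i hi hn := by
    rcases Nat.lt_succ_iff_lt_or_eq.1 hi with hi | hi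
    · exact h.φ_eq i hi hn
    · rw [Fin.ext hi, hk]
  ψ_eq := h.ψ_eq

/-- Covers the direct assignment, the move of `k` to the next target and the replacement of a
duplicate. The second alternative of `hold` drops the former owner of `js`: its dual variable is
`lam`, so slackness survives, and `k` keeps the target assigned. -/
theorem Inv.step_assign {k : Fin n} {js : Fin m} (h : Inv C lam k L φ ψ) (hk : φ k ≤ lam)
    (hf : ∀ j, φ k + ψ j ≤ C k j) (ht : φ k + ψ js = C k js)
    (hlast : ∀ i j, L i = some j → j ≤ js) (hL' : L' k = some js)
    (hold : ∀ i, i ≠ k → L' i = L i ∨ (L' i = none ∧ φ i = lam ∧ L i = some js))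
    (hjs : ∀ i, i ≠ k → L' i ≠ some js) :
    Inv C lam (k + 1) L' φ ψ := by
  have old : ∀ i j, i ≠ k → L' i = some j → L i = some j ∧ i < k ∧ j < js := by
    intro i j hik hi
    have hi' : L i = some j := by
      rcases hold i hik with h1 | h1
      · rw [← h1]; exact hi
      · rw [h1.1] at hi; simp at hi
    refine ⟨hi', h.dom i j hi', lt_of_le_of_ne (hlast i j hi') ?_⟩
    rintro rfl
    exact hjs i hik hi
  exact
  { adm := by
      intro i i' j j' hii hi hi'
      by_cases hk' : i' = k
      · subst hk'
        rw [hL'] at hi'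
        obtain rfl := Option.some_inj.1 hi'
        exact (old i j hii.ne hi).2.2
      · have h' := old i' j' hk' hi'
        have h'' := old i j (hii.trans h'.2.1).ne hi
        exact h.adm i i' j j' hii h''.1 h'.1
    dom := by
      intro i j hi
      by_cases hk' : i = k
      · rw [hk']; exact Nat.lt_succ_self _
      · have : i.val < k.val := (old i j hk' hi).2.1
        omega
    feas := by
      intro i j hi
      rcases Nat.lt_succ_iff_lt_or_eq.1 hi with hi | hi
      · exact h.feas i j hi
      · rw [Fin.ext hi]; exact hf j
    tight := by
      intro i j hi
      by_cases hk' : i = k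
      · subst hk'
        rw [hL'] at hi
        obtain rfl := Option.some_inj.1 hi
        exact ht
      · exact h.tight i j (old i j hk' hi).1
    φ_le := by
      intro i hi
      rcases Nat.lt_succ_iff_lt_or_eq.1 hi with hi | hi
      · exact h.φ_le i hi
      · rw [Fin.ext hi]; exact hk
    ψ_le := h.ψ_le
    φ_eq := by
      intro i hi hn
      rcases Nat.lt_succ_iff_lt_or_eq.1 hi with hi | hi
      · rcases hold i (Fin.ne_of_lt hi) with h1 | h1
        · exact h.φ_eq i hi (h1 ▸ hn)
        · exact h1.2.1
      · rw [Fin.ext hi, hL'] at hn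
        simp at hn
    ψ_eq := by
      intro j hj
      refine h.ψ_eq j fun i hi => ?_
      have hik : i ≠ k := Fin.ne_of_lt (h.dom i j hi)
      rcases hold i hik with h1 | h1
      · exact hj i (h1.trans hi)
      · rw [h1.2.2] at hi
        exact hj k (hL'.trans hi) }

theorem Inv.chain {k a : Fin n} {js : Fin m} (h : Inv C lam k L φ ψ) (hk : φ k ≤ lam)
    (hf : ∀ j, φ k + ψ j ≤ C k j) (ht : φ k + ψ js = C k js)
    (hlast : ∀ i j, L i = some j → j ≤ js) (ha : L a = some js) (hak : k.val = a.val + 1) :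
    Chain C lam k js a js L φ ψ where
  adm := h.adm
  dom := h.dom
  feas i j hi := by
    rcases lt_or_eq_of_le hi with hi | rfl
    · exact h.feas i j hi
    · exact hf j
  tight := h.tight
  φ_le i hi := by
    rcases lt_or_eq_of_le hi with hi | rfl
    · exact h.φ_le i hi
    · exact hk
  ψ_le := h.ψ_le
  φ_eq := h.φ_eq
  ψ_eq := h.ψ_eq
  last := hlast
  lt := h.dom a js ha
  block i h1 h2 := by
    obtain rfl : i = a := by
      apply Fin.ext
      rw [Fin.le_def] at h1
      rw [Fin.lt_def] at h2
      omega
    exact ⟨js, ha, rfl⟩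
  size := by omega
  next i i' j h1 h2 h3 h4 := by
    rw [Fin.le_def] at h1 h3
    obtain rfl : i = a := Fin.ext (by omega)
    obtain rfl : i' = k := Fin.ext (by omega)
    rw [ha] at h4
    obtain rfl := Option.some_inj.1 h4
    exact ht

/-! ### Raising the dual variables of a chain -/

section Chain

variable {k a : Fin n} {js b : Fin m}

theorem Chain.le (h : Chain C lam k js a b L φ ψ) : b ≤ js := by
  have h1 := h.size
  have h2 : a.val < k.val := h.lt
  rw [Fin.le_def]
  omega

theorem Chain.first (h : Chain C lam k js a b L φ ψ) : L a = some b := by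
  obtain ⟨j, h1, h2⟩ := h.block a le_rfl h.lt
  obtain rfl : j = b := Fin.ext (by omega)
  exact h1

theorem Chain.source (h : Chain C lam k js a b L φ ψ) {j : Fin m} (h1 : b ≤ j) (h2 : j ≤ js) :
    ∃ i, a ≤ i ∧ i < k ∧ L i = some j := by
  have hs := h.size
  rw [Fin.le_def] at h1 h2
  have hk := k.2
  have ha : a ≤ (⟨a.val + (j.val - b.val), by omega⟩ : Fin n) := by rw [Fin.le_def]; simp
  have hk : (⟨a.val + (j.val - b.val), by omega⟩ : Fin n) < k := by
    rw [Fin.lt_def]; simp only; omega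
  refine ⟨_, ha, hk, ?_⟩
  obtain ⟨j', e1, e2⟩ := h.block _ ha hk
  rw [e1]
  congr 1
  apply Fin.ext
  simp only at e2
  omega

/-- Sources from `a` on have targets from `b` on by the block structure; sources before `a` have
targets before `b` by admissibility. -/
theorem Chain.mem_iff (h : Chain C lam k js a b L φ ψ) {i : Fin n} {j : Fin m}
    (hi : L i = some j) : a ≤ i ↔ b ≤ j := by
  constructor
  · intro hai
    obtain ⟨j', e1, e2⟩ := h.block i hai (h.dom i j hi)
    rw [hi] at e1
    obtain rfl := Option.some_inj.1 e1
    rw [Fin.le_def] at hai ⊢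
    omega
  · intro hbj
    by_contra hlt
    exact absurd (h.adm i a j b (not_le.1 hlt) hi h.first) (not_lt.2 hbj)

theorem Chain.tight_last (h : Chain C lam k js a b L φ ψ) : φ k + ψ js = C k js := by
  obtain ⟨i, h1, h2, h3⟩ := h.source h.le le_rfl
  obtain ⟨j, h4, h5⟩ := h.block i h1 h2
  rw [h3] at h4
  obtain rfl := Option.some_inj.1 h4
  have := h.size
  exact h.next i k js h1 (by omega) le_rfl h3

/-- Targets past `js` are free, so their `ψ` is `lam`. In row `k`, quasi-convexity bounds the cost
at `js + 1` by that at `j`, and the corner bound passes to `j`, or by that at `js`, and then `Δ ≤ 0`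
and the old constraint suffices. The Monge inequality with column `js` carries the bound from row
`k` to row `i`. -/
theorem Chain.slack_right (hC : SortedCost C dup) (h : Chain C lam k js a b L φ ψ) {Δ : ℝ}
    (hα : ∀ j : Fin m, j.val = js.val + 1 → φ k + Δ + ψ j ≤ C k j) {i : Fin n}
    {j : Fin m} (hi : i ≤ k) (hj : js < j) : φ i + Δ + ψ j ≤ C i j := by
  have free : ∀ l, js < l → ψ l = lam := fun l hl =>
    h.ψ_eq l fun i hi => absurd (h.last i l hi) (not_le.2 hl)
  have hk : φ k + Δ + ψ j ≤ C k j := by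
    rw [Fin.lt_def] at hj
    have hj2 := j.2
    set l : Fin m := ⟨js.val + 1, by omega⟩ with hl
    have hjl : js < l := by rw [Fin.lt_def]; simp [hl]
    have hlj : l ≤ j := by rw [Fin.le_def]; simp only [hl]; omega
    have e1 := free l hjl
    have e2 := free j hj
    have e3 := hα l rfl
    have e4 := h.tight_last
    rcases le_max_iff.1 (hC.row k js l j hjl.le hlj) with e | e
    · have := h.feas k j le_rfl
      have := h.ψ_le js
      linarith
    · linarith
  have := hC.monge i k js j hi hj.le
  linarith [h.tight_last, h.feas i js hi]

/-- The mirror image, with one more case: if `b - 1` is assigned, its owner precedes the chain, and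
the Monge inequality with the owner's row replaces quasi-convexity of row `a`. -/
theorem Chain.slack_left (hC : SortedCost C dup) (h : Chain C lam k js a b L φ ψ) {Δ : ℝ}
    (hβ : ∀ j : Fin m, j.val + 1 = b.val → φ a + Δ + ψ j ≤ C a j) {i : Fin n}
    {j : Fin m} (hi : a ≤ i) (hik : i ≤ k) (hj : j < b) : φ i + Δ + ψ j ≤ C i j := by
  have tb := h.tight a b h.first
  have ha : φ a + Δ + ψ j ≤ C a j := by
    rw [Fin.lt_def] at hj
    have hb2 := b.2
    set l : Fin m := ⟨b.val - 1, by omega⟩ with hl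
    have hjl : j ≤ l := by rw [Fin.le_def]; simp only [hl]; omega
    have hlb : l ≤ b := by rw [Fin.le_def]; simp [hl]
    have e3 := hβ l (by simp only [hl]; omega)
    by_cases hl' : ∃ i', L i' = some l
    · obtain ⟨i', hi'⟩ := hl'
      have hia : i' < a := by
        by_contra hlt
        have := (h.mem_iff hi').1 (not_lt.1 hlt)
        rw [Fin.le_def] at this
        simp only [hl] at this
        omega
      have := hC.monge i' a j l hia.le hjl
      linarith [h.tight i' l hi', h.feas i' j (h.dom i' l hi').le]
    · have e1 := h.ψ_eq l fun i hi => hl' ⟨i, hi⟩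
      have e2 := h.ψ_le j
      have e5 := h.ψ_le b
      rcases le_max_iff.1 (hC.row a j l b hjl hlb) with e | e
      · linarith
      · have := h.feas a j h.lt.le
        linarith
  have := hC.monge a i j b hi hj.le
  linarith [h.feas i b hik]

/-- Inside the chain the two changes cancel, and outside its rows the constraints can only relax.
What remains are chain rows in columns left or right of the block, which the two corner conditions
control. -/
theorem Chain.raise (hC : SortedCost C dup) (h : Chain C lam k js a b L φ ψ) {Δ : ℝ}
    (h0 : 0 ≤ Δ) (hφ : ∀ i, a ≤ i → i ≤ k → φ i + Δ ≤ lam)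
    (hα : ∀ j : Fin m, j.val = js.val + 1 → φ k + Δ + ψ j ≤ C k j)
    (hβ : ∀ j : Fin m, j.val + 1 = b.val → φ a + Δ + ψ j ≤ C a j) :
    Chain C lam k js a b L (fun i => if a ≤ i ∧ i ≤ k then φ i + Δ else φ i)
      fun j => if b ≤ j ∧ j ≤ js then ψ j - Δ else ψ j where
  adm := h.adm
  dom := h.dom
  feas i j hi := by
    have hf := h.feas i j hi
    by_cases hai : a ≤ i
    · rw [if_pos ⟨hai, hi⟩]
      split_ifs with hj
      · linarith
      · rcases lt_or_ge j b with hjb | hjb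
        · exact h.slack_left hC hβ hai hi hjb
        · exact h.slack_right hC hα hi (lt_of_not_ge fun h' => hj ⟨hjb, h'⟩)
    · rw [if_neg fun h' => hai h'.1]
      split_ifs with hj
      · linarith
      · exact hf
  tight i j hi := by
    have ht := h.tight i j hi
    have hik := (h.dom i j hi).le
    have hj := h.last i j hi
    have := h.mem_iff hi
    by_cases hai : a ≤ i
    · rw [if_pos ⟨hai, hik⟩, if_pos ⟨this.1 hai, hj⟩]
      linarith
    · rw [if_neg fun h' => hai h'.1, if_neg fun h' => hai (this.2 h'.1)]
      exact ht
  φ_le i hi := by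
    split_ifs with h1
    · exact hφ i h1.1 h1.2
    · exact h.φ_le i hi
  ψ_le j := by
    split_ifs with h1
    · linarith [h.ψ_le j]
    · exact h.ψ_le j
  φ_eq i hi hn := by
    rw [if_neg, h.φ_eq i hi hn]
    rintro ⟨h1, -⟩
    obtain ⟨j, h2, -⟩ := h.block i h1 hi
    rw [hn] at h2
    simp at h2
  ψ_eq j hj := by
    rw [if_neg, h.ψ_eq j hj]
    rintro ⟨h1, h2⟩
    obtain ⟨i, -, -, h3⟩ := h.source h1 h2
    exact hj i h3
  last := h.last
  lt := h.lt
  block := h.block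
  size := h.size
  next i i' j h1 h2 h3 h4 := by
    have hi' : a ≤ i' := by rw [Fin.le_def] at h1 ⊢; omega
    rw [if_pos ⟨hi', h3⟩, if_pos ⟨(h.mem_iff h4).1 h1, h.last i j h4⟩]
    linarith [h.next i i' j h1 h2 h3 h4]

/-! ### The outcomes of the sub-routine -/

theorem Chain.finish_unassigned (h : Chain C lam k js a b L φ ψ) (hk : φ k = lam) :
    Inv C lam (k + 1) L φ ψ where
  adm := h.adm
  dom i j hi := (Fin.lt_def.1 (h.dom i j hi)).trans (Nat.lt_succ_self _)
  feas i j hi := h.feas i j (Fin.le_def.2 (Nat.lt_succ_iff.1 hi))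
  tight := h.tight
  φ_le i hi := h.φ_le i (Fin.le_def.2 (Nat.lt_succ_iff.1 hi))
  ψ_le := h.ψ_le
  φ_eq i hi hn := by
    rcases Nat.lt_succ_iff_lt_or_eq.1 hi with hi | hi
    · exact h.φ_eq i hi hn
    · rw [Fin.ext hi, hk]
  ψ_eq := h.ψ_eq

theorem Chain.inv (h : Chain C lam k js a b L φ ψ) : Inv C lam k L φ ψ where
  adm := h.adm
  dom := h.dom
  feas i j hi := h.feas i j (Fin.le_def.2 hi.le)
  tight := h.tight
  φ_le i hi := h.φ_le i (Fin.le_def.2 hi.le)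
  ψ_le := h.ψ_le
  φ_eq := h.φ_eq
  ψ_eq := h.ψ_eq

theorem Chain.finish_right (h : Chain C lam k js a b L φ ψ) {j : Fin m} (hj : js < j)
    (ht : φ k + ψ j = C k j) : Inv C lam (k + 1) (Function.update L k (some j)) φ ψ :=
  h.inv.step_assign (h.φ_le k le_rfl) (fun j => h.feas k j le_rfl) ht
    (fun i l hi => (h.last i l hi).trans hj.le) (Function.update_self _ _ _)
    (fun i hi => Or.inl (Function.update_of_ne hi _ _))
    (fun i hi hL => by
      rw [Function.update_of_ne hi] at hL
      exact absurd (h.last i j hL) (not_le.2 hj))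

/-- The assignment is shifted by one on a final segment of the chain; assigned target points remain
assigned. -/
theorem Chain.finish_shift (h : Chain C lam k js a b L φ ψ) {e : Fin n} (hae : a ≤ e) (hek : e < k)
    (hk : L' k = some js)
    (hshift : ∀ i, e < i → i < k →
      ∃ j j' : Fin m, L i = some j ∧ j'.val + 1 = j.val ∧ L' i = some j')
    (hold : ∀ i, i < e → L' i = L i ∨ (L' i = none ∧ φ i = lam ∧ L' e = L i))
    (hnew : ∀ i, k < i → L' i = none)
    (he : (L' e = none ∧ φ e = lam) ∨ ∃ j : Fin m, e = a ∧ L' e = some j ∧ j.val + 1 = b.val ∧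
      φ e + ψ j = C e j ∧ ∀ i, i < e → L' i ≠ some j) :
    Inv C lam (k + 1) L' φ ψ ∧ ∀ i j, L i = some j → ∃ i', L' i' = some j := by
  have hsize := h.size
  rw [Fin.le_def] at hae
  rw [Fin.lt_def] at hek
  -- Since the block is consecutive, the new target of `i` is the old target of `i - 1`; this
  -- includes `k`, which receives `js`.
  have shifted : ∀ i : Fin n, e < i → i ≤ k → ∃ j' : Fin m, L' i = some j' ∧
      j'.val + a.val + 1 = b.val + i.val := by
    intro i h1 h2
    rcases lt_or_eq_of_le h2 with h2 | rfl
    · obtain ⟨j, j', e1, e2, e3⟩ := hshift i h1 h2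
      obtain ⟨l, e4, e5⟩ := h.block i (Fin.le_def.2 (hae.trans h1.le)) h2
      rw [e1] at e4
      obtain rfl := Option.some_inj.1 e4
      exact ⟨j', e3, by omega⟩
    · exact ⟨js, hk, by omega⟩
  have pos : ∀ i j, L' i = some j → (i.val < e.val ∧ L i = some j ∧ j.val + a.val < b.val + e.val) ∨
      (i = e ∧ e = a ∧ j.val + 1 = b.val ∧ φ e + ψ j = C e j ∧ ∀ i, i < e → L' i ≠ some j) ∨
      (e.val < i.val ∧ i.val ≤ k.val ∧ j.val + a.val + 1 = b.val + i.val) := by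
    intro i j hi
    rcases lt_trichotomy i e with hie | rfl | hie
    · left
      have hLi : L i = some j := by
        rcases hold i hie with h1 | h1
        · rw [← h1]; exact hi
        · rw [h1.1] at hi; simp at hi
      refine ⟨hie, hLi, ?_⟩
      obtain ⟨l, e4, e5⟩ := h.block e (Fin.le_def.2 hae) hek
      have := h.adm i e j l hie hLi e4
      rw [Fin.lt_def] at this
      omega
    · right; left
      rcases he with h1 | ⟨l, h1, h2, h3, h4⟩
      · rw [h1.1] at hi; simp at hi
      · rw [hi] at h2
        obtain rfl := Option.some_inj.1 h2
        exact ⟨rfl, h1, h3, h4⟩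
    · right; right
      have hik : i ≤ k := by
        by_contra hlt
        rw [hnew i (not_le.1 hlt)] at hi
        simp at hi
      obtain ⟨l, h1, h2⟩ := shifted i hie hik
      rw [hi] at h1
      obtain rfl := Option.some_inj.1 h1
      exact ⟨hie, hik, h2⟩
  -- From `e` on, the target of a source passes to the next source; before `e`, the target of a
  -- dropped source passes to `e`. No target is lost, so `ψ_eq` needs no new check.
  have cover : ∀ i j, L i = some j → ∃ i', L' i' = some j := by
    intro i j hi
    rcases lt_or_ge i e with hie | hie
    · rcases hold i hie with h1 | h1
      · exact ⟨i, h1.trans hi⟩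
      · exact ⟨e, h1.2.2.trans hi⟩
    · have hik := h.dom i j hi
      obtain ⟨l, e1, e2⟩ := h.block i (Fin.le_def.2 (hae.trans hie)) hik
      rw [hi] at e1
      obtain rfl := Option.some_inj.1 e1
      have hk2 := k.2
      rw [Fin.lt_def] at hik
      rw [Fin.le_def] at hie
      set q : Fin n := ⟨i.val + 1, by omega⟩ with hq
      have hqv : q.val = i.val + 1 := rfl
      obtain ⟨l, h1, h2⟩ := shifted q (by rw [Fin.lt_def]; omega) (by rw [Fin.le_def]; omega)
      obtain rfl : l = j := Fin.ext (by omega)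
      exact ⟨q, h1⟩
  refine ⟨?_, cover⟩
  exact
  { adm := by
      intro i i' j j' hii hi hi'
      have hii' := Fin.lt_def.1 hii
      rcases pos i j hi with h1 | h1 | h1 <;> rcases pos i' j' hi' with h2 | h2 | h2
      · exact h.adm i i' j j' hii h1.2.1 h2.2.1
      · have hne : j ≠ j' := by
          rintro rfl
          exact h2.2.2.2.2 i h1.1 hi
        have hne' : j.val ≠ j'.val := fun h' => hne (Fin.ext h')
        have := h2.2.1
        have := congrArg Fin.val this
        rw [Fin.lt_def]
        omega
      · rw [Fin.lt_def]; omega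
      · have := congrArg Fin.val h1.1
        omega
      · have := congrArg Fin.val h1.1
        have := congrArg Fin.val h2.1
        omega
      · have := congrArg Fin.val h1.1
        have := congrArg Fin.val h1.2.1
        rw [Fin.lt_def]; omega
      · omega
      · have := congrArg Fin.val h2.1
        omega
      · rw [Fin.lt_def]; omega
    dom := by
      intro i j hi
      rcases pos i j hi with h1 | h1 | h1
      · omega
      · rw [h1.1]; omega
      · omega
    feas := fun i j hi => h.feas i j (Fin.le_def.2 (Nat.lt_succ_iff.1 hi))
    tight := by
      intro i j hi
      rcases pos i j hi with h1 | h1 | h1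
      · exact h.tight i j h1.2.1
      · rw [h1.1]; exact h1.2.2.2.1
      -- Here `i` received the old target of `i - 1`, with which it is tight by `next`.
      · have hi2 := i.2
        set p : Fin n := ⟨i.val - 1, by omega⟩ with hp
        have hpv : p.val = i.val - 1 := rfl
        obtain ⟨l, e1, e2⟩ := h.block p (by rw [Fin.le_def]; omega) (by rw [Fin.lt_def]; omega)
        obtain rfl : l = j := Fin.ext (by omega)
        exact h.next p i l (by rw [Fin.le_def]; omega) (by omega) (Fin.le_def.2 h1.2.1) e1
    φ_le := fun i hi => h.φ_le i (Fin.le_def.2 (Nat.lt_succ_iff.1 hi))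
    ψ_le := h.ψ_le
    φ_eq := by
      intro i hi hn
      rcases lt_trichotomy i e with hie | rfl | hie
      · rcases hold i hie with h1 | h1
        · exact h.φ_eq i (hie.trans hek) (h1 ▸ hn)
        · exact h1.2.1
      · rcases he with h1 | ⟨l, h1, h2, h3, h4⟩
        · exact h1.2
        · rw [hn] at h2; simp at h2
      · obtain ⟨l, h1, h2⟩ := shifted i hie (Fin.le_def.2 (Nat.lt_succ_iff.1 hi))
        rw [hn] at h1; simp at h1
    ψ_eq := fun j hj => h.ψ_eq j fun i hi =>
      let ⟨i', hi'⟩ := cover i j hi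
      hj i' hi' }

theorem Chain.extend (h : Chain C lam k js a b L φ ψ) {a' : Fin n} {b' : Fin m}
    (ha : a'.val + 1 = a.val) (hb : b'.val + 1 = b.val) (hL : L a' = some b')
    (ht : φ a + ψ b' = C a b') : Chain C lam k js a' b' L φ ψ where
  adm := h.adm
  dom := h.dom
  feas := h.feas
  tight := h.tight
  φ_le := h.φ_le
  ψ_le := h.ψ_le
  φ_eq := h.φ_eq
  ψ_eq := h.ψ_eq
  last := h.last
  lt := h.dom a' b' hL
  block i h1 h2 := by
    rw [Fin.le_def] at h1
    rcases eq_or_lt_of_le h1 with h1 | h1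
    · obtain rfl := Fin.ext h1
      exact ⟨b', hL, rfl⟩
    · obtain ⟨j, e1, e2⟩ := h.block i (by rw [Fin.le_def]; omega) h2
      exact ⟨j, e1, by omega⟩
  size := by have := h.size; omega
  next i i' j h1 h2 h3 h4 := by
    rw [Fin.le_def] at h1
    rcases eq_or_lt_of_le h1 with h1 | h1
    · obtain rfl := Fin.ext h1
      obtain rfl : i' = a := Fin.ext (by omega)
      rw [hL] at h4
      obtain rfl := Option.some_inj.1 h4
      exact ht
    · exact h.next i i' j (by rw [Fin.le_def]; omega) h2 h3 h4

/-- A target point just before the chain that is assigned is assigned to the source point just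
before the chain, up to duplicates. -/
theorem Chain.gap (hC : SortedCost C dup) (h : Chain C lam k js a b L φ ψ) {i : Fin n} {j : Fin m}
    (hj : j.val + 1 = b.val) (hi : L i = some j) (ht : φ a + ψ j = C a j) (hlt : φ a < lam) :
    i.val + 1 ≤ a.val ∧ (i.val + 1 < a.val → φ i = lam ∧ dup = true) := by
  have hia : i < a := by
    by_contra hlt
    have := (h.mem_iff hi).1 (not_lt.1 hlt)
    rw [Fin.le_def] at this
    omega
  refine ⟨hia, fun hgap => ?_⟩
  have ha2 := a.2
  set p : Fin n := ⟨a.val - 1, by omega⟩ with hp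
  have hpv : p.val = a.val - 1 := rfl
  have hpa : p < a := by rw [Fin.lt_def]; omega
  have hip : i < p := by rw [Fin.lt_def]; omega
  -- The targets `j` and `b` are adjacent, so an admissible plan has no room for a target of `p`
  -- between them.
  have hpn : L p = none := by
    cases hLp : L p with
    | none => rfl
    | some l =>
      have h1 := h.adm i p j l hip hi hLp
      have h2 := h.adm p a l b hpa hLp h.first
      rw [Fin.lt_def] at h1 h2
      omega
  have hpk := hpa.trans h.lt
  exact hC.eq_of_gap hip hpa.le (h.tight i j hi) (h.φ_le i (hip.trans hpk).le) ht hlt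
    (h.φ_eq p hpk hpn) (h.feas p j hpk.le)

/-- The argument of `Chain.gap` with the incoming point as the head: a source strictly between `i`
and `k` would need a target past `js`, where nothing is assigned. -/
theorem Inv.gap (hC : SortedCost C dup) (h : Inv C lam k L φ ψ)
    (hlast : ∀ i j, L i = some j → j ≤ js) {i : Fin n}
    (hi : L i = some js) (ht : φ k + ψ js = C k js) (hlt : φ k < lam) :
    i.val + 1 ≤ k.val ∧ (i.val + 1 < k.val → φ i = lam ∧ dup = true) := by
  have hik := h.dom i js hi
  refine ⟨hik, fun hgap => ?_⟩
  have hk2 := k.2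
  set p : Fin n := ⟨k.val - 1, by omega⟩ with hp
  have hpv : p.val = k.val - 1 := rfl
  have hpk : p < k := by rw [Fin.lt_def]; omega
  have hip : i < p := by rw [Fin.lt_def]; omega
  have hpn : L p = none := by
    cases hLp : L p with
    | none => rfl
    | some l => exact absurd (hlast p l hLp) (not_le.2 (h.adm i p js l hip hi hLp))
  exact hC.eq_of_gap hip hpk.le (h.tight i js hi) (h.φ_le i hik) ht hlt
    (h.φ_eq p hpk hpn) (h.feas p js hpk)

end Chain

end Invariants

/-! ### Total correctness of programs with a step counter -/

/-- The program `p` terminates without an undefined operation, and its value `a` and the number `u`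
of its steps satisfy `Q`. -/
def Runs {α : Type} (p : Exec α) (Q : α → ℕ → Prop) : Prop :=
  ∀ t, ∃ a u, p t = some (a, t + u) ∧ Q a u

section Runs

variable {α β σ ρ : Type}

theorem Runs.mono {p : Exec α} {Q Q' : α → ℕ → Prop} (h : Runs p Q) (hQ : ∀ a u, Q a u → Q' a u) :
    Runs p Q' := fun t =>
  let ⟨a, u, h1, h2⟩ := h t
  ⟨a, u, h1, hQ a u h2⟩

theorem Runs.pure {Q : α → ℕ → Prop} {a : α} (h : Q a 0) : Runs (pure a) Q := fun _ =>
  ⟨a, 0, rfl, h⟩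

theorem Runs.bind {p : Exec α} {f : α → Exec β} {Q : α → ℕ → Prop} {Q' : β → ℕ → Prop}
    (h : Runs p Q) (hf : ∀ a u, Q a u → Runs (f a) fun b u' => Q' b (u + u')) :
    Runs (p >>= f) Q' := by
  intro t
  obtain ⟨a, u, h1, h2⟩ := h t
  obtain ⟨b, u', h3, h4⟩ := hf a u h2 (t + u)
  refine ⟨b, u + u', ?_, h4⟩
  rw [← add_assoc, ← h3]
  change (p t).bind _ = _
  rw [h1]
  rfl

theorem Runs.tick {c : ℕ} {f : Unit → Exec β} {Q : β → ℕ → Prop}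
    (h : Runs (f ()) fun b u => Q b (c + u)) : Runs (tick c >>= f) Q :=
  Runs.bind (Q := fun _ u => u = c) (fun _ => ⟨(), c, rfl, rfl⟩) (by rintro _ _ rfl; exact h)

theorem Runs.need {o : Option α} {a : α} {f : α → Exec β} {Q : β → ℕ → Prop} (ho : o = some a)
    (h : Runs (f a) Q) : Runs (need o >>= f) Q := by
  subst ho
  exact Runs.bind (Q := fun b u => b = a ∧ u = 0) (Runs.pure ⟨rfl, rfl⟩)
    (by rintro _ _ ⟨rfl, rfl⟩; simpa using h)

theorem Runs.argmin {A : ArgminRule} {N : ℕ} {S : Finset (Fin N)} {g : Fin N → EReal}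
    {f : Fin N → Exec β} {Q : β → ℕ → Prop} (hS : S.Nonempty)
    (h : ∀ i ∈ S, (∀ l ∈ S, g i ≤ g l) → Runs (f i) fun b u => Q b (S.card + u)) :
    Runs (argmin A S g >>= f) Q := by
  refine Runs.bind (Q := fun i u => (i ∈ S ∧ ∀ l ∈ S, g i ≤ g l) ∧ u = S.card) ?_ ?_
  · unfold OPT1D.argmin
    refine Runs.tick ?_
    rw [dif_pos hS]
    exact Runs.pure ⟨⟨A.pick_mem S hS g, A.pick_le S hS g⟩, rfl⟩
  · rintro i _ ⟨⟨h1, h2⟩, rfl⟩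
    exact h i h1 h2

theorem loopN_succ (body : σ → Exec (σ ⊕ ρ)) (N : ℕ) (s : σ) (t : ℕ) {r : ρ × ℕ}
    (h : loopN body N s t = some r) : loopN body (N + 1) s t = some r := by
  induction N generalizing s t with
  | zero => simp [loopN, undef] at h
  | succ N ih =>
    rw [loopN] at h ⊢
    change (body s t).bind _ = _ at h
    change (body s t).bind _ = _
    rcases hb : body s t with _ | ⟨s' | r', t'⟩
    · rw [hb] at h; simp at h
    · rw [hb] at h
      exact ih s' t' h
    · rw [hb] at h
      exact h

theorem loopN_mono (body : σ → Exec (σ ⊕ ρ)) {N N' : ℕ} (hN : N ≤ N') (s : σ) (t : ℕ) {r : ρ × ℕ}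
    (h : loopN body N s t = some r) : loopN body N' s t = some r := by
  induction hN with
  | refl => exact h
  | step _ ih => exact loopN_succ body _ s t ih

/-- `loop` uses the least sufficient bound on the passes; as a larger bound never changes a value,
any successful bound determines the result. -/
theorem loop_eq (body : σ → Exec (σ ⊕ ρ)) {N : ℕ} (s : σ) (t : ℕ) {r : ρ × ℕ}
    (h : loopN body N s t = some r) : loop body s t = some r := by
  classical
  have hex : ∃ N, (loopN body N s t).isSome = true := ⟨N, by rw [h]; rfl⟩
  unfold loop
  rw [dif_pos hex]
  have h1 := Nat.find_spec hex
  obtain ⟨r', hr'⟩ := Option.isSome_iff_exists.1 h1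
  have h2 := loopN_mono body (Nat.find_min' hex (by rw [h]; rfl : (loopN body N s t).isSome = true))
    s t hr'
  rw [h] at h2
  rw [h2]
  exact hr'

/-- The rule for loops, with an invariant `I` on the state and the number of steps so far, and a
variant `μ`. -/
theorem Runs.loop {body : σ → Exec (σ ⊕ ρ)} {Q : ρ → ℕ → Prop} (I : σ → ℕ → Prop) (μ : σ → ℕ)
    (hbody : ∀ s u, I s u → Runs (body s) fun r u' =>
      r.elim (fun s' => I s' (u + u') ∧ μ s' < μ s) fun a => Q a (u + u'))
    {s : σ} (h : I s 0) : Runs (loop body s) Q := by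
  have key : ∀ N s u, μ s < N → I s u → Runs (loopN body N s) fun a u' => Q a (u + u') := by
    intro N
    induction N with
    | zero => intro s u hμ; omega
    | succ N ih =>
      intro s u hμ hI
      rw [loopN]
      refine Runs.bind (hbody s u hI) ?_
      rintro (s' | a) u' hr
      · refine (ih s' (u + u') (by have := hr.2; omega) hr.1).mono fun a v hv => ?_
        rwa [← add_assoc]
      · exact Runs.pure hr
  intro t
  obtain ⟨a, u, h1, h2⟩ := key (μ s + 1) s 0 (Nat.lt_succ_self _) h t
  exact ⟨a, u, loop_eq body s t h1, by simpa using h2⟩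

/-- The rule for iteration over a list. -/
theorem Runs.foldlM {ι : Type} {f : σ → ι → Exec σ} (I : ℕ → σ → ℕ → Prop) (l : List ι)
    (hf : ∀ (r : ℕ) (hr : r < l.length) s u, I r s u →
      Runs (f s l[r]) fun s' u' => I (r + 1) s' (u + u'))
    {s : σ} (h : I 0 s 0) : Runs (l.foldlM f s) (I l.length) := by
  -- The invariant is generalised together with the list, because passing to the tail shifts its
  -- index by one.
  have key : ∀ (l : List ι) (I : ℕ → σ → ℕ → Prop), (∀ (r : ℕ) (hr : r < l.length) s u, I r s u →
      Runs (f s l[r]) fun s' u' => I (r + 1) s' (u + u')) →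
      ∀ s u, I 0 s u → Runs (l.foldlM f s) fun s' u' => I l.length s' (u + u') := by
    intro l
    induction l with
    | nil => intro I _ s u h; exact Runs.pure h
    | cons a l ih =>
      intro I hf s u h
      rw [List.foldlM_cons]
      refine Runs.bind (hf 0 (by simp) s u h) fun s' u' h' => ?_
      refine (ih (fun r => I (r + 1)) (fun r hr s u hI => ?_) s' (u + u') h').mono fun s u hI => ?_
      · exact hf (r + 1) (by simpa using hr) s u hI
      · rw [← add_assoc]; exact hI
  exact (key l I hf s 0 h).mono fun a u hI => by simpa using hI

theorem Runs.foldlM_finRange {n : ℕ} {f : σ → Fin n → Exec σ} (I : ℕ → σ → ℕ → Prop)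
    (hf : ∀ (k : Fin n) s u, I k s u → Runs (f s k) fun s' u' => I (k + 1) s' (u + u'))
    {s : σ} (h : I 0 s 0) : Runs ((List.finRange n).foldlM f s) (I n) := by
  have := Runs.foldlM (f := f) I (List.finRange n) (fun r hr s u hI => by
    have := hf ⟨r, by simpa using hr⟩ s u hI
    simpa using this) h
  simpa using this

end Runs

/-! ### Index arithmetic and lists of indices -/

section Indices

variable {N n m : ℕ}

theorem prev?_of_succ {i i' : Fin N} (h : i'.val + 1 = i.val) : prev? i = some i' := by
  unfold prev?
  rw [if_pos (by omega)]
  congr 1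
  apply Fin.ext
  simp only
  omega

theorem next?_of_succ {i i' : Fin N} (h : i'.val = i.val + 1) : next? i = some i' := by
  unfold next?
  rw [dif_pos (h ▸ i'.2)]
  congr 1
  apply Fin.ext
  exact h.symm

theorem prev?_cases (i : Fin N) :
    (prev? i = none ∧ i.val = 0) ∨ ∃ i', prev? i = some i' ∧ i'.val + 1 = i.val := by
  rcases Nat.eq_zero_or_pos i.val with h | h
  · left
    exact ⟨by unfold prev?; rw [if_neg (by omega)], h⟩
  · right
    have := i.2
    exact ⟨⟨i.val - 1, by omega⟩, prev?_of_succ (by simp only; omega), by simp only; omega⟩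

theorem next?_cases (i : Fin N) :
    (next? i = none ∧ i.val + 1 = N) ∨ ∃ i', next? i = some i' ∧ i'.val = i.val + 1 := by
  by_cases h : i.val + 1 < N
  · right
    exact ⟨⟨i.val + 1, h⟩, next?_of_succ rfl, rfl⟩
  · left
    exact ⟨by unfold next?; rw [dif_neg h], by have := i.2; omega⟩

theorem mem_between {a b i : Fin N} : i ∈ between a b ↔ a < i ∧ i < b := by
  simp [between]

theorem mem_fromTo {a b i : Fin N} : i ∈ fromTo a b ↔ a ≤ i ∧ i < b := by
  simp [fromTo]

theorem between_nodup (a b : Fin N) : (between a b).Nodup := (List.nodup_finRange N).filter _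

theorem fromTo_nodup (a b : Fin N) : (fromTo a b).Nodup := (List.nodup_finRange N).filter _

theorem length_between_le (a b : Fin N) : (between a b).length ≤ N :=
  (List.length_filter_le _ _).trans (List.length_finRange).le

theorem length_fromTo_le (a b : Fin N) : (fromTo a b).length ≤ N :=
  (List.length_filter_le _ _).trans (List.length_finRange).le

theorem assignee_eq_none {L : Fin n → Option (Fin m)} {j : Fin m} (h : assignee L j = none)
    (i : Fin n) : L i ≠ some j := by
  unfold assignee at h
  rw [List.find?_eq_none] at h
  simpa using h i (List.mem_finRange i)

theorem assignee_eq_some {L : Fin n → Option (Fin m)} {j : Fin m} {i : Fin n}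
    (h : assignee L j = some i) : L i = some j := by
  unfold assignee at h
  simpa using List.find?_some h

/-- Without repetitions in the list, each entry still has its original value when it is read. -/
theorem shiftDown_runs (is : List (Fin n)) (his : is.Nodup) (L : Fin n → Option (Fin m))
    (h : ∀ i ∈ is, ∃ j j' : Fin m, L i = some j ∧ j'.val + 1 = j.val) :
    Runs (shiftDown is L) fun L' _ =>
      (∀ i ∈ is, ∃ j j' : Fin m, L i = some j ∧ j'.val + 1 = j.val ∧ L' i = some j') ∧
      ∀ i, i ∉ is → L' i = L i := by
  unfold shiftDown
  induction is generalizing L with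
  | nil => exact Runs.pure ⟨by simp, fun _ _ => rfl⟩
  | cons a is ih =>
    rw [List.foldlM_cons]
    obtain ⟨j, j', h1, h2⟩ := h a (by simp)
    obtain ⟨ha, his'⟩ := List.nodup_cons.1 his
    have hne : ∀ i ∈ is, i ≠ a := fun i hi hia => ha (hia ▸ hi)
    refine Runs.bind (Q := fun L' _ => L' = Function.update L a (some j')) ?_ ?_
    · exact Runs.tick (Runs.need h1 (Runs.need (prev?_of_succ h2) (Runs.pure rfl)))
    · rintro _ u rfl
      refine (ih his' _ fun i hi => ?_).mono ?_
      · obtain ⟨l, l', e1, e2⟩ := h i (List.mem_cons_of_mem _ hi)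
        exact ⟨l, l', by rw [Function.update_of_ne (hne i hi)]; exact e1, e2⟩
      · rintro L' _ ⟨e1, e2⟩
        constructor
        · intro i hi
          rcases List.mem_cons.1 hi with rfl | hi
          · exact ⟨j, j', h1, h2, by rw [e2 _ ha, Function.update_self]⟩
          · obtain ⟨l, l', e3, e4, e5⟩ := e1 i hi
            rw [Function.update_of_ne (hne i hi)] at e3
            exact ⟨l, l', e3, e4, e5⟩
        · intro i hi
          rw [List.mem_cons, not_or] at hi
          rw [e2 i hi.2, Function.update_of_ne hi.1]

end Indices

/-! ### The reassignments that complete an iteration -/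

section Shift

variable {n m : ℕ} {C : Fin n → Fin m → ℝ} {lam : ℝ}
  {L L' : Fin n → Option (Fin m)} {φ : Fin n → ℝ} {ψ : Fin m → ℝ} {k a : Fin n} {js b : Fin m}

/-- `L'` arises from `L` by replacing `L_i` by `L_i - 1` for `i` in `is`. -/
def IsShift (is : List (Fin n)) (L L' : Fin n → Option (Fin m)) : Prop :=
  (∀ i ∈ is, ∃ j j' : Fin m, L i = some j ∧ j'.val + 1 = j.val ∧ L' i = some j') ∧
    ∀ i, i ∉ is → L' i = L i

/-- Sources after the head have targets strictly above `b`, so the preceding target exists. -/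
theorem Chain.shiftable (h : Chain C lam k js a b L φ ψ) {e : Fin n} (hae : a ≤ e)
    {L₀ : Fin n → Option (Fin m)} (hL : ∀ i, e < i → i < k → L₀ i = L i) :
    ∀ i ∈ between e k, ∃ j j' : Fin m, L₀ i = some j ∧ j'.val + 1 = j.val := by
  intro i hi
  obtain ⟨h1, h2⟩ := mem_between.1 hi
  obtain ⟨j, h3, h4⟩ := h.block i (hae.trans h1.le) h2
  have hj := j.2
  have : a.val < i.val := lt_of_le_of_lt hae h1
  exact ⟨j, ⟨j.val - 1, by omega⟩, (hL i h1 h2).trans h3, by simp only; omega⟩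

theorem update_unassign {e : Fin n} :
    ∀ i, e < i → i < k →
      Function.update (Function.update L e none) k (some js) i = L i := fun i h1 h2 => by
  rw [Function.update_of_ne h2.ne, Function.update_of_ne h1.ne']

theorem Chain.finish_drop (h : Chain C lam k js a b L φ ψ) {e : Fin n} (hae : a ≤ e) (hek : e < k)
    (he : φ e = lam)
    (hL' : IsShift (between e k) (Function.update (Function.update L e none) k (some js)) L') :
    Inv C lam (k + 1) L' φ ψ ∧ ∀ i j, L i = some j → ∃ i', L' i' = some j := by
  obtain ⟨h1, h2⟩ := hL'
  have hnot : ∀ i, ¬ (e < i ∧ i < k) →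
      L' i = Function.update (Function.update L e none) k (some js) i := fun i hi =>
    h2 i fun hm => hi (mem_between.1 hm)
  refine h.finish_shift hae hek ?_ ?_ ?_ ?_ (Or.inl ⟨?_, he⟩)
  · rw [hnot k (by simp), Function.update_self]
  · intro i hei hik
    obtain ⟨j, j', h3, h4, h5⟩ := h1 i (mem_between.2 ⟨hei, hik⟩)
    rw [Function.update_of_ne hik.ne, Function.update_of_ne hei.ne'] at h3
    exact ⟨j, j', h3, h4, h5⟩
  · intro i hi
    rw [hnot i fun h' => absurd h'.1 (not_lt.2 hi.le), Function.update_of_ne (hi.trans hek).ne,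
      Function.update_of_ne hi.ne]
    exact Or.inl rfl
  · intro i hi
    rw [hnot i fun h' => absurd h'.2 (not_lt.2 hi.le), Function.update_of_ne hi.ne',
      Function.update_of_ne (hek.trans hi).ne']
    cases hLi : L i with
    | none => rfl
    | some j => exact absurd (h.dom i j hLi) (not_lt.2 hi.le)
  · rw [hnot e (by simp), Function.update_of_ne hek.ne, Function.update_self]

/-- `L₁` is either the plan itself, if `j` is free, or the plan without the duplicate that owned
`j`; both ways of taking over `j` are treated at once. -/
theorem Chain.finish_left (h : Chain C lam k js a b L φ ψ) {j : Fin m} (hj : j.val + 1 = b.val)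
    (ht : φ a + ψ j = C a j) {L₁ : Fin n → Option (Fin m)}
    (hL₁ : ∀ i, i < a → L₁ i ≠ some j ∧ (L₁ i = L i ∨ (L₁ i = none ∧ φ i = lam ∧ L i = some j)))
    (hL₁' : ∀ i, a < i → L₁ i = L i)
    (hL' : IsShift (between a k) (Function.update (Function.update L₁ a (some j)) k (some js)) L') :
    Inv C lam (k + 1) L' φ ψ ∧ ∀ i j, L i = some j → ∃ i', L' i' = some j := by
  obtain ⟨h1, h2⟩ := hL'
  have hak := h.lt
  have hnot : ∀ i, ¬ (a < i ∧ i < k) →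
      L' i = Function.update (Function.update L₁ a (some j)) k (some js) i := fun i hi =>
    h2 i fun hm => hi (mem_between.1 hm)
  have hlt : ∀ i, i < a → L' i = L₁ i := fun i hi => by
    rw [hnot i fun h' => absurd h'.1 (not_lt.2 hi.le), Function.update_of_ne (hi.trans hak).ne,
      Function.update_of_ne hi.ne]
  have ha : L' a = some j := by
    rw [hnot a (by simp), Function.update_of_ne hak.ne, Function.update_self]
  refine h.finish_shift le_rfl hak ?_ ?_ ?_ ?_ (Or.inr ⟨j, rfl, ha, hj, ht, ?_⟩)
  · rw [hnot k (by simp), Function.update_self]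
  · intro i hei hik
    obtain ⟨j, j', h3, h4, h5⟩ := h1 i (mem_between.2 ⟨hei, hik⟩)
    rw [Function.update_of_ne hik.ne, Function.update_of_ne hei.ne', hL₁' i hei] at h3
    exact ⟨j, j', h3, h4, h5⟩
  · intro i hi
    rw [hlt i hi, ha]
    rcases (hL₁ i hi).2 with h3 | ⟨h3, h4, h5⟩
    · exact Or.inl h3
    · exact Or.inr ⟨h3, h4, h5.symm⟩
  · intro i hi
    rw [hnot i fun h' => absurd h'.2 (not_lt.2 hi.le), Function.update_of_ne hi.ne',
      Function.update_of_ne (hak.trans hi).ne', hL₁' i (hak.trans hi)]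
    cases hLi : L i with
    | none => rfl
    | some j => exact absurd (h.dom i j hLi) (not_lt.2 hi.le)
  · intro i hi
    rw [hlt i hi]
    exact (hL₁ i hi).1

theorem Inv.step_free (h : Inv C lam k L φ ψ) (hk : φ k ≤ lam) (hf : ∀ j, φ k + ψ j ≤ C k j)
    (ht : φ k + ψ js = C k js) (hlast : ∀ i j, L i = some j → j ≤ js)
    (hfree : ∀ i, L i ≠ some js) : Inv C lam (k + 1) (Function.update L k (some js)) φ ψ :=
  h.step_assign hk hf ht hlast (Function.update_self _ _ _)
    (fun _ hik => Or.inl (Function.update_of_ne hik _ _))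
    fun i hik => by rw [Function.update_of_ne hik]; exact hfree i

theorem Inv.step_swap (h : Inv C lam k L φ ψ) (hk : φ k ≤ lam) (hf : ∀ j, φ k + ψ j ≤ C k j)
    (ht : φ k + ψ js = C k js) (hlast : ∀ i j, L i = some j → j ≤ js) {i : Fin n}
    (hi : L i = some js) (hφ : φ i = lam) :
    Inv C lam (k + 1) (Function.update (Function.update L i none) k (some js)) φ ψ := by
  refine h.step_assign hk hf ht hlast (Function.update_self _ _ _) (fun l hlk => ?_)
    fun l hlk => ?_
  · rw [Function.update_of_ne hlk]
    by_cases hli : l = i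
    · subst hli
      rw [Function.update_self]
      exact Or.inr ⟨rfl, hφ, hi⟩
    · rw [Function.update_of_ne hli]
      exact Or.inl rfl
  · rw [Function.update_of_ne hlk]
    by_cases hli : l = i
    · subst hli
      rw [Function.update_self]
      simp
    · rw [Function.update_of_ne hli]
      exact fun h' => hli (h.adm.injOn h' hi)

end Shift

/-! ### Correctness of the primal-dual algorithm -/

theorem isOptimalOutput_of_inv {n m : ℕ} {c : ℝ → ℝ → ℝ} {x : Fin n → ℝ} {y : Fin m → ℝ} {lam : ℝ}
    {L : Fin n → Option (Fin m)} {Φ : Fin n → EReal} {Ψ : Fin m → EReal} {φ : Fin n → ℝ}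
    {ψ : Fin m → ℝ} (h : Inv (fun i j => c (x i) (y j)) lam n L φ ψ) (hΦ : ∀ i, Φ i = (φ i : EReal))
    (hΨ : ∀ j, Ψ j = (ψ j : EReal)) : IsOptimalOutput c x y lam L Φ Ψ :=
  ⟨h.isOptimal.1, φ, ψ, hΦ, hΨ, h.isOptimal.2⟩

theorem coe_min (r s : ℝ) : min (r : EReal) (s : EReal) = ((min r s : ℝ) : EReal) :=
  (EReal.coe_strictMono.monotone.map_min).symm

section Basic

variable {n m : ℕ} {c : ℝ → ℝ → ℝ} {x : Fin n → ℝ} {y : Fin m → ℝ} {lam : ℝ} {dup : Bool}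

/-- The invariant of the main loop for extended real dual variables. -/
def EInv (c : ℝ → ℝ → ℝ) (x : Fin n → ℝ) (y : Fin m → ℝ) (lam : ℝ) (k : ℕ)
    (L : Fin n → Option (Fin m)) (Φ : Fin n → EReal) (Ψ : Fin m → EReal) : Prop :=
  ∃ φ ψ, Inv (fun i j => c (x i) (y j)) lam k L φ ψ ∧ (∀ i : Fin n, i.val < k → Φ i = (φ i : EReal)) ∧
    ∀ j, Ψ j = (ψ j : EReal)

/-- The invariant of the sub-routine for extended real dual variables. -/
def EChain (c : ℝ → ℝ → ℝ) (x : Fin n → ℝ) (y : Fin m → ℝ) (lam : ℝ) (k : Fin n) (js : Fin m)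
    (a : Fin n) (b : Fin m) (s : Vars n m) : Prop :=
  ∃ φ ψ, Chain (fun i j => c (x i) (y j)) lam k js a b s.L φ ψ ∧
    (∀ i, i ≤ k → s.Φ i = (φ i : EReal)) ∧ ∀ j, s.Ψ j = (ψ j : EReal)

/-- `⊤` stands for a missing neighbour, so a strict inequality below some value exhibits the
neighbour. -/
theorem elim_top_spec {o : Option (Fin m)} {f : Fin m → EReal} :
    (∀ j, o = some j → o.elim ⊤ f = f j) ∧ (∀ r : EReal, o.elim ⊤ f < r → ∃ j, o = some j) := by
  cases o <;> simp

theorem subOptBody_runs (A : ArgminRule) (hC : SortedCost (fun i j => c (x i) (y j)) dup)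
    {k a : Fin n} {js b : Fin m} {s : Vars n m} (h : EChain c x y lam k js a b s) :
    Runs (subOptBody A dup c x y lam k js (a, b, s)) fun r _ =>
      r.elim (fun st => EChain c x y lam k js st.1 st.2.1 st.2.2 ∧ st.1.val < a.val)
        fun s' => EInv c x y lam (k + 1) s'.L s'.Φ s'.Ψ := by
  obtain ⟨φ, ψ, hc, hΦ, hΨ⟩ := h
  have hak := hc.lt
  unfold subOptBody
  refine Runs.argmin ⟨k, Finset.mem_Icc.2 ⟨hak.le, le_rfl⟩⟩ fun e he hmin => ?_
  dsimp only
  obtain ⟨hae, hek⟩ := Finset.mem_Icc.1 he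
  have hgap : ∀ i, i ≤ k → (lam : EReal) - s.Φ i = ((lam - φ i : ℝ) : EReal) := fun i hi => by
    rw [hΦ i hi, EReal.coe_sub]
  rw [hgap e hek]
  set Δ := lam - φ e with hΔ
  have hmin' : ∀ i, a ≤ i → i ≤ k → Δ ≤ lam - φ i := fun i h1 h2 => by
    have := hmin i (Finset.mem_Icc.2 ⟨h1, h2⟩)
    rw [hgap e hek, hgap i h2] at this
    exact EReal.coe_le_coe_iff.1 this
  obtain ⟨α1, α2⟩ := elim_top_spec (o := next? js)
    (f := fun j => (c (x k) (y j) : EReal) - s.Φ k - s.Ψ j)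
  obtain ⟨β1, β2⟩ := elim_top_spec (o := prev? b)
    (f := fun j => (c (x a) (y j) : EReal) - s.Φ a - s.Ψ j)
  generalize (next? js).elim ⊤ (fun j => (c (x k) (y j) : EReal) - s.Φ k - s.Ψ j) = α at *
  generalize (prev? b).elim ⊤ (fun j => (c (x a) (y j) : EReal) - s.Φ a - s.Ψ j) = β at *
  have hα : ∀ j : Fin m, j.val = js.val + 1 → α = ((c (x k) (y j) - φ k - ψ j : ℝ) : EReal) :=
    fun j hj => by
      rw [α1 j (next?_of_succ hj), hΦ k le_rfl, hΨ, EReal.coe_sub, EReal.coe_sub]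
  have hβ : ∀ j : Fin m, j.val + 1 = b.val → β = ((c (x a) (y j) - φ a - ψ j : ℝ) : EReal) :=
    fun j hj => by
      rw [β1 j (prev?_of_succ hj), hΦ a hak.le, hΨ, EReal.coe_sub, EReal.coe_sub]
  -- A finite increment below all three thresholds keeps the chain; a threshold `⊤` belongs to a
  -- corner that does not exist.
  have hraise : ∀ δ : ℝ, 0 ≤ δ → δ ≤ Δ → (δ : EReal) ≤ α → (δ : EReal) ≤ β →
      ∃ φ' ψ', Chain (fun i j => c (x i) (y j)) lam k js a b s.L φ' ψ' ∧
        (∀ i, i ≤ k → (raise a k b js δ s).Φ i = (φ' i : EReal)) ∧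
        (∀ j, (raise a k b js δ s).Ψ j = (ψ' j : EReal)) ∧
        (∀ i, a ≤ i → i ≤ k → φ' i = φ i + δ) ∧ (∀ j, j < b ∨ js < j → ψ' j = ψ j) := by
    intro δ h0 h1 h2 h3
    refine ⟨_, _, hc.raise hC h0 (fun i h4 h5 => by linarith [hmin' i h4 h5]) (fun j hj => ?_)
      (fun j hj => ?_), fun i hi => ?_, fun j => ?_, fun i h4 h5 => if_pos ⟨h4, h5⟩,
      fun j hj => if_neg ?_⟩
    · rw [hα j hj] at h2
      linarith [EReal.coe_le_coe_iff.1 h2]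
    · rw [hβ j hj] at h3
      linarith [EReal.coe_le_coe_iff.1 h3]
    · simp only [raise]
      split_ifs
      · rw [hΦ i hi, EReal.coe_add]
      · exact hΦ i hi
    · simp only [raise]
      split_ifs
      · rw [hΨ j, EReal.coe_sub]
      · exact hΨ j
    · rintro ⟨h4, h5⟩
      exact hj.elim (not_lt.2 h4) (not_lt.2 h5)
  have hΔ0 : 0 ≤ Δ := by linarith [hc.φ_le e hek]
  refine Runs.tick ?_
  split_ifs with h31 h32 h33
  · -- the gap is closed and `k` remains unassigned
    obtain ⟨φ', ψ', hc', hΦ', hΨ', e1, -⟩ := hraise Δ hΔ0 le_rfl (h31.trans (min_le_left _ _))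
      (h31.trans (min_le_right _ _))
    refine Runs.tick (Runs.pure ?_)
    refine ⟨φ', ψ', hc'.finish_unassigned ?_, fun i hi => hΦ' i (Fin.le_def.2 (by omega)), hΨ'⟩
    rw [e1 k hak.le le_rfl, hΔ, h32]
    ring
  · obtain ⟨φ', ψ', hc', hΦ', hΨ', e1, -⟩ := hraise Δ hΔ0 le_rfl (h31.trans (min_le_left _ _))
      (h31.trans (min_le_right _ _))
    refine Runs.tick (Runs.tick ?_)
    have hek' := lt_of_le_of_ne hek h32
    refine Runs.bind (shiftDown_runs _ (between_nodup _ _) _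
      (hc'.shiftable hae update_unassign)) ?_
    intro L' u hL'
    refine Runs.pure ?_
    refine ⟨φ', ψ', (hc'.finish_drop hae hek' ?_ hL').1, fun i hi => hΦ' i (Fin.le_def.2 (by omega)),
      hΨ'⟩
    rw [e1 e hae hek, hΔ]
    ring
  · -- the next target point is free
    obtain ⟨j, hj⟩ : ∃ j, next? js = some j := by
      rcases not_le.1 h31 |> min_lt_iff.1 with h4 | h4
      · exact α2 _ h4
      · exact α2 _ ((h33.trans (min_le_right _ _)).trans_lt h4)
    have hj' : j.val = js.val + 1 := by
      rcases next?_cases js with h4 | ⟨j', h4, h5⟩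
      · rw [h4.1] at hj; simp at hj
      · rw [hj] at h4
        rwa [Option.some_inj.1 h4]
    have hαj := hα j hj'
    have hjs : js < j := by rw [Fin.lt_def]; omega
    rw [hαj] at h33
    obtain ⟨φ', ψ', hc', hΦ', hΨ', e1, e2⟩ := hraise (c (x k) (y j) - φ k - ψ j)
      (by linarith [hc.feas k j le_rfl]) (EReal.coe_le_coe_iff.1 (h33.trans (min_le_left _ _)))
      hαj.ge (h33.trans (min_le_right _ _))
    rw [hαj]
    refine Runs.tick (Runs.need hj (Runs.tick (Runs.pure ?_)))
    refine ⟨φ', ψ', hc'.finish_right hjs ?_, fun i hi => hΦ' i (Fin.le_def.2 (by omega)), hΨ'⟩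
    rw [e1 k hak.le le_rfl, e2 j (Or.inr hjs)]
    ring
  -- With the first two cases excluded, `β` is strictly below both other thresholds. So it is not
  -- `⊤`, and `φ' a` stays strictly below `lam`, as `Chain.gap` requires.
  · have hβα : β < α ∧ β < (Δ : EReal) := by
      rw [not_le] at h31 h33
      rcases min_lt_iff.1 h31 with h4 | h4 <;> rcases min_lt_iff.1 h33 with h5 | h5
      · exact absurd h4 (not_lt.2 h5.le)
      · exact ⟨h5, h5.trans h4⟩
      · exact ⟨h4.trans h5, h4⟩
      · exact ⟨h5, h4⟩
    obtain ⟨j, hj⟩ := β2 _ hβα.1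
    have hj' : j.val + 1 = b.val := by
      rcases prev?_cases b with h4 | ⟨j', h4, h5⟩
      · rw [h4.1] at hj; simp at hj
      · rw [hj] at h4
        rwa [Option.some_inj.1 h4]
    have hβj := hβ j hj'
    rw [hβj] at hβα
    have hlt : c (x a) (y j) - φ a - ψ j < Δ := EReal.coe_lt_coe_iff.1 hβα.2
    have hjb : j < b := by rw [Fin.lt_def]; omega
    obtain ⟨φ', ψ', hc', hΦ', hΨ', e1, e2⟩ := hraise (c (x a) (y j) - φ a - ψ j)
      (by linarith [hc.feas a j hak.le]) hlt.le hβα.1.le hβj.ge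
    rw [hβj]
    have ht : φ' a + ψ' j = c (x a) (y j) := by
      rw [e1 a le_rfl hak.le, e2 j (Or.inl hjb)]
      ring
    have hφa : φ' a < lam := by
      rw [e1 a le_rfl hak.le]
      linarith [hmin' a le_rfl hak.le]
    refine Runs.tick (Runs.need hj (Runs.tick ?_))
    split
    · rename_i hnone
      have hfree := assignee_eq_none hnone
      refine Runs.tick (Runs.bind (shiftDown_runs _ (between_nodup _ _) _
        (hc'.shiftable le_rfl (fun i h1 h2 => ?_))) ?_)
      · rw [Function.update_of_ne h2.ne, Function.update_of_ne h1.ne']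
        rfl
      · intro L' u hL'
        refine Runs.pure ?_
        exact ⟨φ', ψ', (hc'.finish_left hj' ht (fun i _ => ⟨hfree i, Or.inl rfl⟩) (fun _ _ => rfl)
            hL').1,
          fun i hi => hΦ' i (Fin.le_def.2 (by omega)), hΨ'⟩
    · rename_i i hi
      have hi : s.L i = some j := assignee_eq_some hi
      obtain ⟨g1, g2⟩ := hc'.gap hC hj' hi ht hφa
      have hia : i < a := g1
      split_ifs with hd
      · refine Runs.tick (Runs.bind (shiftDown_runs _ (between_nodup _ _) _
          (hc'.shiftable le_rfl (fun l h1 h2 => ?_))) ?_)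
        · rw [Function.update_of_ne h2.ne, Function.update_of_ne h1.ne',
            Function.update_of_ne (hia.trans h1).ne']
          rfl
        · intro L' u hL'
          refine Runs.pure ?_
          refine ⟨φ', ψ', (hc'.finish_left hj' ht (fun l hl => ?_) (fun l hl => ?_) hL').1,
            fun i hi => hΦ' i (Fin.le_def.2 (by omega)), hΨ'⟩
          · by_cases hli : l = i
            · subst hli
              rw [Function.update_self]
              exact ⟨by simp, Or.inr ⟨rfl, (g2 hd.2).1, hi⟩⟩
            · rw [Function.update_of_ne hli]
              exact ⟨fun h' => hli (hc.adm.injOn h' hi), Or.inl rfl⟩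
          · rw [Function.update_of_ne (hia.trans hl).ne']
            rfl
      -- A gap forces `dup = true` and would have led to the preceding branch.
      · have hsucc : i.val + 1 = a.val := by
          by_contra hne
          have hgt : i.val + 1 < a.val := by omega
          exact hd ⟨(g2 hgt).2, hgt⟩
        refine Runs.need (prev?_of_succ hsucc) (Runs.tick (Runs.pure ?_))
        exact ⟨⟨φ', ψ', hc'.extend hsucc hj' hi ht, hΦ', hΨ'⟩, hia⟩

theorem subOpt_runs (A : ArgminRule) (hC : SortedCost (fun i j => c (x i) (y j)) dup)
    {k a : Fin n} {js : Fin m} {s : Vars n m} (hak : a.val + 1 = k.val)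
    (h : EChain c x y lam k js a js s) :
    Runs (subOpt A dup c x y lam k js s) fun s' _ =>
      EInv c x y lam (k + 1) s'.L s'.Φ s'.Ψ := by
  unfold subOpt
  refine Runs.need (prev?_of_succ hak) (Runs.tick ?_)
  refine Runs.loop (fun st _ => EChain c x y lam k js st.1 st.2.1 st.2.2) (fun st => st.1.val) ?_ h
  rintro ⟨a, b, s⟩ u hs
  exact subOptBody_runs A hC hs

/-- The outcome of the minimisation in an iteration of the main loop. -/
theorem Inv.select {C : Fin n → Fin m → ℝ} {L : Fin n → Option (Fin m)} {φ : Fin n → ℝ}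
    {ψ : Fin m → ℝ} {k : Fin n} (hC : SortedCost C dup) (h : Inv C lam k L φ ψ)
    {S : Finset (Fin m)} {Φ : Fin n → EReal} {Ψ : Fin m → EReal}
    (hΦ : ∀ i : Fin n, i.val < k.val → Φ i = (φ i : EReal)) (hΨ : ∀ j, Ψ j = (ψ j : EReal))
    {js : Fin m} (hmin : ∀ j ∈ S, (C k js : EReal) - Ψ js ≤ (C k j : EReal) - Ψ j)
    (hS : ∀ j, j ∉ S → ∃ i j', L i = some j' ∧ j ≤ j' ∧ j' ∈ S) :
    ∃ φ', Inv C lam k L φ' ψ ∧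
      min ((C k js : EReal) - Ψ js) lam = (φ' k : EReal) ∧
      (∀ i : Fin n, i.val < k.val + 1 → Function.update Φ k (min ((C k js : EReal) - Ψ js) lam) i
        = (φ' i : EReal)) ∧
      (∀ j, φ' k + ψ j ≤ C k j) ∧ φ' k ≤ lam ∧ (φ' k ≠ lam → φ' k + ψ js = C k js) ∧
      (dup = false → ∀ i j, L i = some j → j ≤ js) := by
  have hmin' : ∀ j ∈ S, C k js - ψ js ≤ C k j - ψ j := fun j hj => by
    have := hmin j hj
    rw [hΨ, hΨ, ← EReal.coe_sub, ← EReal.coe_sub] at this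
    exact EReal.coe_le_coe_iff.1 this
  -- An excluded index is dominated by an assigned one that is still a candidate.
  have hall : ∀ j, C k js - ψ js ≤ C k j - ψ j := fun j => by
    by_cases hj : j ∈ S
    · exact hmin' j hj
    · obtain ⟨i, j', h1, h2, h3⟩ := hS j hj
      exact (hmin' j' h3).trans (h.le_reduced hC h1 h2)
  have e : min ((C k js : EReal) - Ψ js) lam = ((min (C k js - ψ js) lam : ℝ) : EReal) := by
    rw [hΨ, ← EReal.coe_sub, coe_min]
  refine ⟨Function.update φ k (min (C k js - ψ js) lam), h.update_dual _, ?_, ?_, ?_, ?_, ?_, ?_⟩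
  · rw [Function.update_self, e]
  · intro i hi
    by_cases hik : i = k
    · subst hik
      rw [Function.update_self, Function.update_self, e]
    · rw [Function.update_of_ne hik, Function.update_of_ne hik]
      refine hΦ i ?_
      have : i.val ≠ k.val := fun h' => hik (Fin.ext h')
      omega
  · intro j
    rw [Function.update_self]
    linarith [hall j, min_le_left (C k js - ψ js) lam]
  · rw [Function.update_self]
    exact min_le_right _ _
  · rw [Function.update_self]
    intro hne
    rcases min_choice (C k js - ψ js) lam with h1 | h1
    · rw [h1]; ring
    · exact absurd h1 hne
  · intro hd i j hi
    by_contra hlt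
    exact absurd (hall j) (not_le.2 (h.lt_reduced hC hd hi (not_le.1 hlt)))

theorem opt1dStep_runs (hm : 0 < m) (A : ArgminRule)
    (hC : SortedCost (fun i j => c (x i) (y j)) dup)
    {k : Fin n} {s : Vars n m} (h : EInv c x y lam k s.L s.Φ s.Ψ) :
    Runs (opt1dStep A dup c x y lam s k) fun s' _ =>
      EInv c x y lam (k + 1) s'.L s'.Φ s'.Ψ := by
  obtain ⟨φ, ψ, hi, hΦ, hΨ⟩ := h
  unfold opt1dStep
  -- The last target index is never smaller than an assigned one, so the set of candidates is
  -- nonempty.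
  refine Runs.argmin ⟨⟨m - 1, by omega⟩, ?_⟩ fun js hjs hmin => ?_
  · simp only [Finset.mem_filter, Finset.mem_univ, true_and]
    intro _ _ j' _
    rw [Fin.le_def]
    simp only
    omega
  dsimp only
  have hS : ∀ j, j ∉ (Finset.univ.filter fun j : Fin m =>
      dup = true → ∀ i j', s.L i = some j' → j' ≤ j) → ∃ i j', s.L i = some j' ∧ j ≤ j' ∧
      j' ∈ (Finset.univ.filter fun j : Fin m =>
        dup = true → ∀ i j', s.L i = some j' → j' ≤ j) := by
    intro j hj
    simp only [Finset.mem_filter, Finset.mem_univ, true_and] at hj ⊢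
    push Not at hj
    obtain ⟨-, i, j', h1, h2⟩ := hj
    obtain ⟨l, hl, hmax⟩ := Finset.exists_max_image
      (Finset.univ.filter fun l : Fin m => ∃ i, s.L i = some l) id ⟨j', by simpa using ⟨i, h1⟩⟩
    simp only [Finset.mem_filter, Finset.mem_univ, true_and, id] at hl hmax
    obtain ⟨i', hi'⟩ := hl
    exact ⟨i', l, hi', h2.le.trans (hmax j' ⟨i, h1⟩), fun _ i j h3 => hmax j ⟨i, h3⟩⟩
  obtain ⟨φ', hi', e1, hΦ', hf, hle, ht, hlast⟩ := hi.select hC hΦ hΨ hmin hS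
  have hlast : ∀ i j, s.L i = some j → j ≤ js := by
    cases hd : dup with
    | false => exact hlast hd
    | true => exact (Finset.mem_filter.1 hjs).2 hd
  refine Runs.tick ?_
  split_ifs with h1
  · rw [e1] at h1
    exact Runs.pure ⟨φ', ψ, hi'.step_unassigned (EReal.coe_eq_coe_iff.1 h1) hf, hΦ', hΨ⟩
  · rw [e1, EReal.coe_eq_coe_iff] at h1
    have ht := ht h1
    refine Runs.tick ?_
    split
    · rename_i hnone
      have hfree := assignee_eq_none hnone
      exact Runs.tick (Runs.pure ⟨φ', ψ, hi'.step_free hle hf ht hlast hfree, hΦ', hΨ⟩)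
    · rename_i i hias
      have hias : s.L i = some js := assignee_eq_some hias
      obtain ⟨g1, g2⟩ := hi'.gap hC hlast hias ht (lt_of_le_of_ne hle h1)
      split_ifs with hd
      · exact Runs.tick (Runs.pure
          ⟨φ', ψ, hi'.step_swap hle hf ht hlast hias (g2 hd.2).1, hΦ', hΨ⟩)
      · have hsucc : i.val + 1 = k.val := by
          by_contra hne
          have hgt : i.val + 1 < k.val := by omega
          exact hd ⟨(g2 hgt).2, hgt⟩
        have hch := hi'.chain hle hf ht hlast hias hsucc.symm
        exact subOpt_runs A hC hsucc
          ⟨φ', ψ, hch, fun l hl => hΦ' l (Nat.lt_succ_of_le hl), hΨ⟩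

theorem opt1d_correct (hm : 0 < m) (A : ArgminRule)
    (hC : SortedCost (fun i j => c (x i) (y j)) dup) :
    Runs (opt1d A dup c x y lam) fun out _ => IsOptimalOutput c x y lam out.L out.Φ out.Ψ := by
  unfold opt1d
  refine Runs.tick ?_
  refine (Runs.foldlM_finRange (fun k s _ => EInv c x y lam k s.L s.Φ s.Ψ)
    (fun k s u hs => opt1dStep_runs hm A hC hs) ⟨fun _ => 0, fun _ => lam, inv_zero, ?_, ?_⟩).mono ?_
  · intro i hi; simp at hi
  · intro j; rfl
  · rintro s u ⟨φ, ψ, h1, h2, h3⟩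
    exact isOptimalOutput_of_inv h1 (fun i => h2 i i.2) h3

end Basic

/-! ### The inverse array -/

section Inverse

variable {n m : ℕ} {L L' L₁ : Fin n → Option (Fin m)} {R R' R₁ : Fin m → Option (Fin n)}

/-- `R` is the inverse array of `L`. -/
def IsInverse (L : Fin n → Option (Fin m)) (R : Fin m → Option (Fin n)) : Prop :=
  ∀ i j, L i = some j ↔ R j = some i

/-- Inverse entries are overwritten but never erased. This is sound because, by `hcov`, a target
without a source in the new plan had none before, and its entry is untouched. At assigned targets,
`fwd` determines the entry and so gives the converse as well. -/
theorem isInverse_of_isShift {is : List (Fin n)} {k : Fin n} {js : Fin m} (hinv : IsInverse L R)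
    (hadm : IsAdmissible L') (hcov : ∀ i j, L i = some j → ∃ i', L' i' = some j) (hk : k ∉ is)
    (hsh : IsShift is (Function.update L₁ k (some js)) L')
    (hR : ∀ i ∈ is, ∀ j, L' i = some j → R' j = some i)
    (hR' : ∀ j, (∀ i ∈ is, L' i ≠ some j) → R' j = Function.update R₁ js (some k) j)
    (h1 : ∀ i j, i ≠ k → L₁ i = some j → L' i = some j → R₁ j = some i)
    (h2 : ∀ j, (∀ i, L' i ≠ some j) → R₁ j = R j) : IsInverse L' R' := by
  have hk' : L' k = some js := by rw [hsh.2 k hk, Function.update_self]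
  have fwd : ∀ i j, L' i = some j → R' j = some i := by
    intro i j hi
    by_cases his : i ∈ is
    · exact hR i his j hi
    · rw [hR' j fun i' hi' h => his (hadm.injOn h hi ▸ hi')]
      by_cases hik : i = k
      · subst hik
        rw [hk'] at hi
        obtain rfl := Option.some_inj.1 hi
        rw [Function.update_self]
      · rw [Function.update_of_ne]
        · refine h1 i j hik ?_ hi
          rw [hsh.2 i his, Function.update_of_ne hik] at hi
          exact hi
        · rintro rfl
          exact hik (hadm.injOn hi hk')
  refine fun i j => ⟨fwd i j, fun hRj => ?_⟩
  by_cases hex : ∃ i', L' i' = some j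
  · obtain ⟨i', hi'⟩ := hex
    rw [fwd i' j hi'] at hRj
    rwa [← Option.some_inj.1 hRj]
  · push Not at hex
    rw [hR' j fun i' _ => hex i', Function.update_of_ne (fun h => hex k (hk'.trans (congrArg some h.symm))),
      h2 j hex, ← hinv] at hRj
    obtain ⟨i', hi'⟩ := hcov i j hRj
    exact absurd hi' (hex i')

theorem isInverse_update {k : Fin n} {js : Fin m} (hinv : IsInverse L R)
    (hadm : IsAdmissible (Function.update L₁ k (some js)))
    (hcov : ∀ i j, L i = some j → j ≠ js → ∃ i', i' ≠ k ∧ L₁ i' = some j)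
    (hL₁ : ∀ i j, L₁ i = some j → L i = some j) :
    IsInverse (Function.update L₁ k (some js)) (Function.update R js (some k)) := by
  refine isInverse_of_isShift (is := []) (L₁ := L₁) (R₁ := R) hinv hadm (fun i j hi => ?_)
    List.not_mem_nil ⟨by simp, fun _ _ => rfl⟩ (by simp) (fun _ _ => rfl)
    (fun i j _ h _ => (hinv i j).1 (hL₁ i j h)) fun _ _ => rfl
  by_cases hj : j = js
  · exact ⟨k, by rw [Function.update_self, hj]⟩
  · obtain ⟨i', h3, h4⟩ := hcov i j hi hj
    exact ⟨i', by rw [Function.update_of_ne h3, h4]⟩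

theorem isInverse_swap {k i : Fin n} {js : Fin m} (hinv : IsInverse L R)
    (hadm : IsAdmissible (Function.update (Function.update L i none) k (some js)))
    (hdom : ∀ l j, L l = some j → l ≠ k) (hi : L i = some js) :
    IsInverse (Function.update (Function.update L i none) k (some js))
      (Function.update R js (some k)) := by
  refine isInverse_update hinv hadm (fun l j h2 h3 => ⟨l, hdom l j h2, ?_⟩) fun l j h2 => ?_
  · rw [Function.update_of_ne]
    · exact h2
    · rintro rfl
      rw [hi] at h2
      exact h3 (Option.some_inj.1 h2).symm
  · by_cases hli : l = i
    · rw [hli, Function.update_self] at h2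
      simp at h2
    · rwa [Function.update_of_ne hli] at h2

theorem Runs.assign {β : Type} {i : Fin n} {j : Fin m} {s : FullVars n m}
    {f : FullVars n m → Exec β} {Q : β → ℕ → Prop}
    (h : Runs (f { s with L := Function.update s.L i (some j), R := Function.update s.R j (some i) })
      fun b u => Q b (2 + u)) : Runs (assign i j s >>= f) Q :=
  Runs.bind (Q := fun s' u => s' = { s with
      L := Function.update s.L i (some j), R := Function.update s.R j (some i) } ∧ u = 2)
    (Runs.tick (Runs.pure ⟨rfl, rfl⟩)) (by rintro _ _ ⟨rfl, rfl⟩; exact h)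

theorem Runs.unassign {β : Type} {i : Fin n} {s : FullVars n m}
    {f : FullVars n m → Exec β} {Q : β → ℕ → Prop}
    (h : Runs (f { s with L := Function.update s.L i none }) fun b u => Q b (1 + u)) :
    Runs (unassign i s >>= f) Q :=
  Runs.bind (Q := fun s' u => s' = { s with L := Function.update s.L i none } ∧ u = 1)
    (Runs.tick (Runs.pure ⟨rfl, rfl⟩)) (by rintro _ _ ⟨rfl, rfl⟩; exact h)

/-- Injectivity on the list makes the new targets distinct, so no later write to the inverse array
destroys an earlier one. -/
theorem shiftDownFull_runs (is : List (Fin n)) (his : is.Nodup) (s : FullVars n m)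
    (h : ∀ i ∈ is, ∃ j j' : Fin m, s.L i = some j ∧ j'.val + 1 = j.val)
    (hinj : ∀ i ∈ is, ∀ i' ∈ is, s.L i = s.L i' → i = i') :
    Runs (shiftDownFull is s) fun s' u => IsShift is s.L s'.L ∧
      (∀ i ∈ is, ∀ j, s'.L i = some j → s'.R j = some i) ∧
      (∀ j, (∀ i ∈ is, s'.L i ≠ some j) → s'.R j = s.R j) ∧
      s'.Φ = s.Φ ∧ s'.Ψ = s.Ψ ∧ s'.jlast = s.jlast ∧ u = 3 * is.length := by
  unfold shiftDownFull
  induction is generalizing s with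
  | nil => exact Runs.pure ⟨⟨by simp, fun _ _ => rfl⟩, by simp, fun _ _ => rfl, rfl, rfl, rfl, rfl⟩
  | cons a is ih =>
    rw [List.foldlM_cons]
    obtain ⟨j, j', h1, h2⟩ := h a (by simp)
    obtain ⟨ha, his'⟩ := List.nodup_cons.1 his
    have hne : ∀ i ∈ is, i ≠ a := fun i hi hia => ha (hia ▸ hi)
    refine Runs.bind (Q := fun s' u => s' = { s with
      L := Function.update s.L a (some j'), R := Function.update s.R j' (some a) } ∧ u = 3) ?_ ?_
    · exact Runs.tick (Runs.need h1 (Runs.need (prev?_of_succ h2)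
        (Runs.tick (Runs.pure ⟨rfl, rfl⟩))))
    · rintro _ u ⟨rfl, rfl⟩
      refine (ih his' _ (fun i hi => ?_) fun i hi i' hi' => ?_).mono ?_
      · obtain ⟨l, l', e1, e2⟩ := h i (List.mem_cons_of_mem _ hi)
        exact ⟨l, l', by dsimp only; rw [Function.update_of_ne (hne i hi)]; exact e1, e2⟩
      · dsimp only
        rw [Function.update_of_ne (hne i hi), Function.update_of_ne (hne i' hi')]
        exact hinj i (List.mem_cons_of_mem _ hi) i' (List.mem_cons_of_mem _ hi')
      · rintro s' u ⟨⟨e1, e2⟩, e3, e4, e5, e6, e7, rfl⟩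
        have hL'a : s'.L a = some j' := by rw [e2 _ ha]; exact Function.update_self _ _ _
        have e1' : ∀ i ∈ is, ∃ j j' : Fin m, s.L i = some j ∧ j'.val + 1 = j.val ∧
            s'.L i = some j' := by
          intro i hi
          obtain ⟨l, l', e3, e4, e5⟩ := e1 i hi
          dsimp only at e3
          rw [Function.update_of_ne (hne i hi)] at e3
          exact ⟨l, l', e3, e4, e5⟩
        refine ⟨⟨?_, ?_⟩, ?_, ?_, e5, e6, e7, ?_⟩
        · intro i hi
          rcases List.mem_cons.1 hi with rfl | hi
          · exact ⟨j, j', h1, h2, hL'a⟩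
          · exact e1' i hi
        · intro i hi
          rw [List.mem_cons, not_or] at hi
          rw [e2 i hi.2]
          exact Function.update_of_ne hi.1 _ _
        · intro i hi l hl
          rcases List.mem_cons.1 hi with rfl | hi
          · rw [hL'a] at hl
            obtain rfl := Option.some_inj.1 hl
            rw [e4]
            · exact Function.update_self _ _ _
            · intro i' hi' hl'
              obtain ⟨q, q', e8, e9, e10⟩ := e1' i' hi'
              rw [hl'] at e10
              obtain rfl := Option.some_inj.1 e10
              obtain rfl : q = j := Fin.ext (by omega)
              exact hne i' hi' (hinj i' (List.mem_cons_of_mem _ hi') i (by simp) (e8.trans h1.symm))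
          · exact e3 i hi l hl
        · intro l hl
          rw [e4 l fun i hi => hl i (List.mem_cons_of_mem _ hi)]
          refine Function.update_of_ne ?_ _ _
          rintro rfl
          exact hl a (by simp) hL'a
        · rw [List.length_cons]; ring

end Inverse

/-! ### The delayed update of the dual variables -/

section Delayed

variable {n m : ℕ} {C : Fin n → Fin m → ℝ} {lam : ℝ} {k a : Fin n} {js b : Fin m}
  {L : Fin n → Option (Fin m)} {φ : Fin n → ℝ} {ψ : Fin m → ℝ} {Φ : Fin n → EReal}
  {Ψ : Fin m → EReal} {v : ℝ} {d : Fin n → ℝ}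

/-- `(φ, ψ)` are the current dual variables if `(Φ, Ψ)` are the stored ones, `v` is the total
increment, and `d i` is the total increment at the time at which `i` entered the chain, which
currently consists of `[a : k]`. -/
structure Delayed (k a : Fin n) (L : Fin n → Option (Fin m)) (Φ : Fin n → EReal) (Ψ : Fin m → EReal)
    (v : ℝ) (d : Fin n → ℝ) (φ : Fin n → ℝ) (ψ : Fin m → ℝ) : Prop where
  Φ_lt : ∀ i, i < a → Φ i = (φ i : EReal)
  Φ_mem : ∀ i, a ≤ i → i < k → Φ i = ((φ i - (v - d i) : ℝ) : EReal)
  Φ_last : Φ k = ((φ k - v : ℝ) : EReal)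
  Ψ_mem : ∀ i j, a ≤ i → i < k → L i = some j → Ψ j = ((ψ j + (v - d i) : ℝ) : EReal)
  Ψ_not_mem : ∀ j, (∀ i, a ≤ i → i < k → L i ≠ some j) → Ψ j = (ψ j : EReal)

/-- On the chain the current variables and `v` move by the same amount, so the stored arrays need no
change. -/
theorem Delayed.raise (h : Delayed k a L Φ Ψ v d φ ψ) (hc : Chain C lam k js a b L φ ψ) (δ : ℝ) :
    Delayed k a L Φ Ψ (v + δ) d (fun i => if a ≤ i ∧ i ≤ k then φ i + δ else φ i)
      fun j => if b ≤ j ∧ j ≤ js then ψ j - δ else ψ j where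
  Φ_lt i hi := by rw [if_neg fun h' => absurd h'.1 (not_le.2 hi)]; exact h.Φ_lt i hi
  Φ_mem i h1 h2 := by
    rw [if_pos ⟨h1, h2.le⟩, h.Φ_mem i h1 h2]
    congr 1
    ring
  Φ_last := by
    rw [if_pos ⟨hc.lt.le, le_rfl⟩, h.Φ_last]
    congr 1
    ring
  Ψ_mem i j h1 h2 h3 := by
    rw [if_pos ⟨(hc.mem_iff h3).1 h1, hc.last i j h3⟩, h.Ψ_mem i j h1 h2 h3]
    congr 1
    ring
  Ψ_not_mem j hj := by
    rw [if_neg, h.Ψ_not_mem j hj]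
    rintro ⟨h1, h2⟩
    obtain ⟨i, h3, h4, h5⟩ := hc.source h1 h2
    exact hj i h3 h4 h5

/-- The entering point gets `d = v`: its pending increment is zero, and its stored values are still
the current ones. -/
theorem Delayed.extend (h : Delayed k a L Φ Ψ v d φ ψ) (hL : IsAdmissible L)
    {a' : Fin n} {b' : Fin m}
    (ha : a'.val + 1 = a.val) (hb : L a' = some b') :
    Delayed k a' L Φ Ψ v (Function.update d a' v) φ ψ := by
  have haa : a' < a := by rw [Fin.lt_def]; omega
  have hor : ∀ i, a' ≤ i → i = a' ∨ (a ≤ i ∧ i ≠ a') := by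
    intro i hi
    rw [Fin.le_def] at hi
    rcases eq_or_lt_of_le hi with h1 | h1
    · exact Or.inl (Fin.ext h1.symm)
    · exact Or.inr ⟨by rw [Fin.le_def]; omega, fun h' => by simp [h'] at h1⟩
  exact
  { Φ_lt := fun i hi => h.Φ_lt i (hi.trans haa)
    Φ_mem := by
      intro i h1 h2
      rcases hor i h1 with rfl | ⟨h3, h4⟩
      · rw [h.Φ_lt i haa, Function.update_self]
        congr 1
        ring
      · rw [Function.update_of_ne h4]
        exact h.Φ_mem i h3 h2
    Φ_last := h.Φ_last
    Ψ_mem := by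
      intro i j h1 h2 h5
      rcases hor i h1 with rfl | ⟨h3, h4⟩
      · rw [h.Ψ_not_mem j, Function.update_self]
        · congr 1
          ring
        · intro i' h6 h7 h8
          exact absurd (hL.injOn h8 h5) (haa.trans_le h6).ne'
      · rw [Function.update_of_ne h4]
        exact h.Ψ_mem i j h3 h2 h5
    Ψ_not_mem := fun j hj => h.Ψ_not_mem j fun i h1 h2 => hj i (haa.le.trans h1) h2 }

theorem applyDuals_fold (is : List (Fin n)) (his : is.Nodup) (v : EReal) (d : Fin n → EReal)
    (s : FullVars n m) (hdom : ∀ i ∈ is, ∃ j, s.L i = some j)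
    (hinj : ∀ i ∈ is, ∀ i' ∈ is, s.L i = s.L i' → i = i') :
    Runs (is.foldlM (fun (s : FullVars n m) i => do
      tick 3
      let j ← need (s.L i)
      pure { s with
        Φ := Function.update s.Φ i (s.Φ i + (v - d i))
        Ψ := Function.update s.Ψ j (s.Ψ j - (v - d i)) }) s) fun s' u =>
      s'.L = s.L ∧ s'.R = s.R ∧ s'.jlast = s.jlast ∧
      (∀ i ∈ is, s'.Φ i = s.Φ i + (v - d i)) ∧ (∀ i, i ∉ is → s'.Φ i = s.Φ i) ∧
      (∀ i ∈ is, ∀ j, s.L i = some j → s'.Ψ j = s.Ψ j - (v - d i)) ∧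
      (∀ j, (∀ i ∈ is, s.L i ≠ some j) → s'.Ψ j = s.Ψ j) ∧ u = 3 * is.length := by
  induction is generalizing s with
  | nil => exact Runs.pure (by simp)
  | cons a is ih =>
    rw [List.foldlM_cons]
    obtain ⟨j, hj⟩ := hdom a (by simp)
    obtain ⟨ha, his'⟩ := List.nodup_cons.1 his
    have hne : ∀ i ∈ is, i ≠ a := fun i hi hia => ha (hia ▸ hi)
    have hnj : ∀ i ∈ is, s.L i ≠ some j := fun i hi hij =>
      hne i hi (hinj i (List.mem_cons_of_mem _ hi) a (by simp) (hij.trans hj.symm))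
    refine Runs.bind (Q := fun s' u => s' = { s with
        Φ := Function.update s.Φ a (s.Φ a + (v - d a))
        Ψ := Function.update s.Ψ j (s.Ψ j - (v - d a)) } ∧ u = 3)
      (Runs.tick (Runs.need hj (Runs.pure ⟨rfl, rfl⟩))) ?_
    rintro _ u ⟨rfl, rfl⟩
    refine (ih his' { s with
        Φ := Function.update s.Φ a (s.Φ a + (v - d a))
        Ψ := Function.update s.Ψ j (s.Ψ j - (v - d a)) }
      (fun i hi => hdom i (List.mem_cons_of_mem _ hi))
      fun i hi i' hi' => hinj i (List.mem_cons_of_mem _ hi) i' (List.mem_cons_of_mem _ hi')).mono ?_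
    rintro s' u ⟨e1, e2, e3, e4, e5, e6, e7, rfl⟩
    dsimp only at e1 e2 e3 e4 e5 e6 e7
    refine ⟨e1, e2, e3, ?_, ?_, ?_, ?_, ?_⟩
    · intro i hi
      rcases List.mem_cons.1 hi with rfl | hi
      · rw [e5 i ha, Function.update_self]
      · rw [e4 i hi, Function.update_of_ne (hne i hi)]
    · intro i hi
      rw [List.mem_cons, not_or] at hi
      rw [e5 i hi.2, Function.update_of_ne hi.1]
    · intro i hi l hl
      rcases List.mem_cons.1 hi with rfl | hi
      · rw [hj] at hl
        obtain rfl := Option.some_inj.1 hl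
        rw [e7 j hnj, Function.update_self]
      · rw [e6 i hi l hl, Function.update_of_ne]
        rintro rfl
        exact hnj i hi hl
    · intro l hl
      rw [e7 l fun i hi => hl i (List.mem_cons_of_mem _ hi), Function.update_of_ne]
      rintro rfl
      exact hl a (by simp) hj
    · rw [List.length_cons]; ring

theorem applyDuals_runs {s : FullVars n m} (h : Delayed k a s.L s.Φ s.Ψ v d φ ψ)
    (hc : Chain C lam k js a b s.L φ ψ) :
    Runs (applyDuals a k v (fun i => (d i : EReal)) s) fun s' u =>
      s'.L = s.L ∧ s'.R = s.R ∧ s'.jlast = s.jlast ∧ (∀ i, i ≤ k → s'.Φ i = (φ i : EReal)) ∧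
      (∀ j, s'.Ψ j = (ψ j : EReal)) ∧ u ≤ 3 * n + 1 := by
  unfold applyDuals
  have hsome : ∀ i ∈ fromTo a k, ∃ j, s.L i = some j := fun i hi => by
    obtain ⟨h1, h2⟩ := mem_fromTo.1 hi
    obtain ⟨j, h3, -⟩ := hc.block i h1 h2
    exact ⟨j, h3⟩
  refine Runs.bind (applyDuals_fold _ (fromTo_nodup a k) _ _ s hsome fun i hi i' _ he => ?_) ?_
  · obtain ⟨j, hj⟩ := hsome i hi
    exact hc.adm.injOn hj (he ▸ hj)
  · rintro s' u ⟨e1, e2, e3, e4, e5, e6, e7, rfl⟩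
    refine Runs.tick (Runs.pure ⟨e1, e2, e3, ?_, ?_, ?_⟩)
    · intro i hi
      dsimp only
      rcases lt_or_eq_of_le hi with hik | rfl
      · rw [Function.update_of_ne hik.ne]
        rcases lt_or_ge i a with hia | hia
        · rw [e5 i fun h' => absurd (mem_fromTo.1 h').1 (not_le.2 hia), h.Φ_lt i hia]
        · rw [e4 i (mem_fromTo.2 ⟨hia, hik⟩), h.Φ_mem i hia hik, ← EReal.coe_sub, ← EReal.coe_add]
          congr 1
          ring
      · rw [Function.update_self, e5 i fun h' => absurd (mem_fromTo.1 h').2 (lt_irrefl _), h.Φ_last,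
          ← EReal.coe_add]
        congr 1
        ring
    · intro j
      dsimp only
      by_cases hj : ∃ i, a ≤ i ∧ i < k ∧ s.L i = some j
      · obtain ⟨i, h1, h2, h3⟩ := hj
        rw [e6 i (mem_fromTo.2 ⟨h1, h2⟩) j h3, h.Ψ_mem i j h1 h2 h3, ← EReal.coe_sub,
          ← EReal.coe_sub]
        congr 1
        ring
      · push Not at hj
        rw [e7 j fun i hi => hj i (mem_fromTo.1 hi).1 (mem_fromTo.1 hi).2, h.Ψ_not_mem j hj]
    · have := length_fromTo_le a k
      omega

end Delayed

/-! ### Correctness and running time of the refined version -/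

section Refined

variable {n m : ℕ} {c : ℝ → ℝ → ℝ} {x : Fin n → ℝ} {y : Fin m → ℝ} {lam : ℝ}

/-- The invariant of the main loop of the refined version. -/
structure FullInv (c : ℝ → ℝ → ℝ) (x : Fin n → ℝ) (y : Fin m → ℝ) (lam : ℝ) (k : ℕ)
    (s : FullVars n m) : Prop where
  inv : EInv c x y lam k s.L s.Φ s.Ψ
  inverse : IsInverse s.L s.R
  le_last : ∀ i j, s.L i = some j → j ≤ s.jlast
  last : s.jlast.val = 0 ∨ ∃ i, s.L i = some s.jlast

/-- After this iteration no source beyond `k` is assigned, so admissibility makes the target of `k`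
the last one. -/
theorem FullInv.of_last {k : Fin n} {s : FullVars n m} (h : EInv c x y lam (k + 1) s.L s.Φ s.Ψ)
    (hinv : IsInverse s.L s.R) (hk : s.L k = some s.jlast) : FullInv c x y lam (k + 1) s where
  inv := h
  inverse := hinv
  le_last i j hi := by
    obtain ⟨φ, ψ, h1, -, -⟩ := h
    rcases lt_or_eq_of_le (Fin.le_def.2 (Nat.lt_succ_iff.1 (h1.dom i j hi))) with h2 | rfl
    · exact (h1.adm i k j _ h2 hi hk).le
    · rw [hk] at hi
      exact (Option.some_inj.1 hi).ge
  last := Or.inr ⟨k, hk⟩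

/-- The part of the sub-routine that assigns `k` and shifts the assignment of the chain. -/
theorem shift_runs {ρ : Type} {k a e : Fin n} {js b : Fin m} {L : Fin n → Option (Fin m)}
    {R : Fin m → Option (Fin n)} {φ : Fin n → ℝ} {ψ : Fin m → ℝ} {s : FullVars n m}
    {Q : ρ → ℕ → Prop} {f : FullVars n m → ρ}
    (hc : Chain (fun i j => c (x i) (y j)) lam k js a b L φ ψ) (hae : a ≤ e) (hinv : IsInverse L R)
    (hΦ : ∀ i, i ≤ k → s.Φ i = (φ i : EReal)) (hΨ : ∀ j, s.Ψ j = (ψ j : EReal)) (hjs : s.jlast = js)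
    (hL : ∀ i, e < i → i < k → s.L i = L i)
    (hfin : ∀ L', IsShift (between e k) (Function.update s.L k (some js)) L' →
      Inv (fun i j => c (x i) (y j)) lam (k + 1) L' φ ψ ∧
        ∀ i j, L i = some j → ∃ i', L' i' = some j)
    (h1 : ∀ L', IsShift (between e k) (Function.update s.L k (some js)) L' → IsAdmissible L' →
      ∀ i j, i ≠ k → s.L i = some j → L' i = some j → s.R j = some i)
    (h2 : ∀ L', IsShift (between e k) (Function.update s.L k (some js)) L' →
      ∀ j, (∀ i, L' i ≠ some j) → s.R j = R j)
    (hQ : ∀ s' u, FullInv c x y lam (k + 1) s' → u ≤ 3 * n + 2 → Q (f s') u) :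
    Runs (assign k js s >>= fun s => shiftDownFull (between e k) s >>= fun s => pure (f s)) Q := by
  have hL' : ∀ i, e < i → i < k → Function.update s.L k (some js) i = L i := fun i h3 h4 => by
    rw [Function.update_of_ne h4.ne, hL i h3 h4]
  refine Runs.assign (Runs.bind (shiftDownFull_runs _ (between_nodup e k) _
    (hc.shiftable hae hL') fun i hi i' hi' he => ?_) ?_)
  · obtain ⟨h3, h4⟩ := mem_between.1 hi
    obtain ⟨h5, h6⟩ := mem_between.1 hi'
    dsimp only at he
    rw [hL' i h3 h4, hL' i' h5 h6] at he
    obtain ⟨j, hj, -⟩ := hc.block i (hae.trans h3.le) h4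
    exact hc.adm.injOn hj (he ▸ hj)
  · rintro s' u ⟨e1, e2, e3, e4, e5, e6, rfl⟩
    dsimp only at e1 e3 e4 e5 e6
    have hk : k ∉ between e k := fun h => absurd (mem_between.1 h).2 (lt_irrefl _)
    obtain ⟨hi, hcov⟩ := hfin _ e1
    refine Runs.pure (hQ _ _ (FullInv.of_last ⟨φ, ψ, hi, fun i hi => ?_, fun j => ?_⟩
      (isInverse_of_isShift hinv hi.adm hcov hk e1 e2 e3 (h1 _ e1 hi.adm) (h2 _ e1)) ?_) ?_)
    · rw [e4, hΦ i (Fin.le_def.2 (Nat.lt_succ_iff.1 hi))]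
    · rw [e5, hΨ]
    · rw [e1.2 k hk, Function.update_self, e6, hjs]
    · have := length_between_le e k
      omega

/-- The invariant of the refined sub-routine. -/
structure ChainInv (c : ℝ → ℝ → ℝ) (x : Fin n → ℝ) (y : Fin m → ℝ) (lam : ℝ) (k : Fin n)
    (js : Fin m) (s : FullVars n m) (w : ChainVars n m) (v : ℝ) (d : Fin n → ℝ) (φ : Fin n → ℝ)
    (ψ : Fin m → ℝ) : Prop where
  chain : Chain (fun i j => c (x i) (y j)) lam k js w.imin w.jmin s.L φ ψ
  delayed : Delayed k w.imin s.L s.Φ s.Ψ v d φ ψ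
  v_eq : w.v = (v : EReal)
  d_eq : w.d = fun i => (d i : EReal)
  d_imin : d w.imin = v
  le_iΔ : w.imin ≤ w.iΔ
  iΔ_le : w.iΔ ≤ k
  lamΔ_eq : w.lamΔ = ((lam - φ w.iΔ : ℝ) : EReal)
  iΔ_min : ∀ i, w.imin ≤ i → i ≤ k → φ i ≤ φ w.iΔ

/-- A repeating pass costs at most `4 + 1 + 5 + 2 = 12` steps. A returning pass traverses the chain
at most twice, for the dual variables and for the shift, at three steps per point each. -/
theorem subOptFullBody_runs (hC : SortedCost (fun i j => c (x i) (y j)) true)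
    {k : Fin n} {js : Fin m} {s : FullVars n m} (hinv : IsInverse s.L s.R) (hjs : s.jlast = js)
    {w : ChainVars n m} (h : ∃ v d φ ψ, ChainInv c x y lam k js s w v d φ ψ) :
    Runs (subOptFullBody c x y lam k js s w) fun r u =>
      r.elim (fun w' => (∃ v d φ ψ, ChainInv c x y lam k js s w' v d φ ψ) ∧
          w'.imin.val < w.imin.val ∧ u ≤ 12)
        fun s' => FullInv c x y lam (k + 1) s' ∧ u ≤ 6 * n + 30 := by
  obtain ⟨v, d, φ, ψ, hc, hdel, hv, hd, hda, hae, hek, hΔ, hmin⟩ := h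
  obtain ⟨a, b, v', d', e, Δ'⟩ := w
  dsimp only at hc hdel hv hd hda hae hek hΔ hmin
  subst hv hd hΔ
  have hak := hc.lt
  unfold subOptFullBody
  dsimp only
  -- The head entered the chain at the present increment, so its stored variable is current; hence
  -- `β` needs no correction by `v`, unlike `α`.
  have hΦa : s.Φ a = (φ a : EReal) := by
    rw [hdel.Φ_mem a le_rfl hak, hda]
    congr 1
    ring
  have hΨout : ∀ j, j < b ∨ js < j → s.Ψ j = (ψ j : EReal) := fun j hj =>
    hdel.Ψ_not_mem j fun i h1 _ h3 =>
      hj.elim (not_lt.2 ((hc.mem_iff h3).1 h1)) (not_lt.2 (hc.last i j h3))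
  obtain ⟨α1, α2⟩ := elim_top_spec (o := next? js)
    (f := fun j => (c (x k) (y j) : EReal) - s.Φ k - v - s.Ψ j)
  obtain ⟨β1, β2⟩ := elim_top_spec (o := prev? b)
    (f := fun j => (c (x a) (y j) : EReal) - s.Φ a - s.Ψ j)
  generalize (next? js).elim ⊤ (fun j => (c (x k) (y j) : EReal) - s.Φ k - v - s.Ψ j) = α at *
  generalize (prev? b).elim ⊤ (fun j => (c (x a) (y j) : EReal) - s.Φ a - s.Ψ j) = β at *
  have hα : ∀ j : Fin m, j.val = js.val + 1 → α = ((c (x k) (y j) - φ k - ψ j : ℝ) : EReal) :=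
    fun j hj => by
      rw [α1 j (next?_of_succ hj), hdel.Φ_last, hΨout j (Or.inr (by rw [Fin.lt_def]; omega)),
        ← EReal.coe_sub, ← EReal.coe_sub, ← EReal.coe_sub]
      congr 1
      ring
  have hβ : ∀ j : Fin m, j.val + 1 = b.val → β = ((c (x a) (y j) - φ a - ψ j : ℝ) : EReal) :=
    fun j hj => by
      rw [β1 j (prev?_of_succ hj), hΦa, hΨout j (Or.inl (by rw [Fin.lt_def]; omega)),
        EReal.coe_sub, EReal.coe_sub]
  set Δ := lam - φ e with hΔ
  have hraise : ∀ δ : ℝ, 0 ≤ δ → δ ≤ Δ → (δ : EReal) ≤ α → (δ : EReal) ≤ β →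
      ∃ φ' ψ', Chain (fun i j => c (x i) (y j)) lam k js a b s.L φ' ψ' ∧
        Delayed k a s.L s.Φ s.Ψ (v + δ) d φ' ψ' ∧
        (∀ i, a ≤ i → i ≤ k → φ' i = φ i + δ) ∧ (∀ j, j < b ∨ js < j → ψ' j = ψ j) ∧
        (∀ i, i < a → φ' i = φ i) := by
    intro δ h0 h1 h2 h3
    refine ⟨_, _, hc.raise hC h0 (fun i h4 h5 => by linarith [hmin i h4 h5]) (fun j hj => ?_)
      (fun j hj => ?_), hdel.raise hc δ, fun i h4 h5 => if_pos ⟨h4, h5⟩,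
      fun j hj => if_neg ?_, fun i hi => if_neg fun h' => absurd h'.1 (not_le.2 hi)⟩
    · rw [hα j hj] at h2
      linarith [EReal.coe_le_coe_iff.1 h2]
    · rw [hβ j hj] at h3
      linarith [EReal.coe_le_coe_iff.1 h3]
    · rintro ⟨h4, h5⟩
      exact hj.elim (not_lt.2 h4) (not_lt.2 h5)
  have hΔ0 : 0 ≤ Δ := by linarith [hc.φ_le e hek]
  refine Runs.tick ?_
  split_ifs with h31 h32 h33
  · obtain ⟨φ', ψ', hc', hdel', e1, -, -⟩ := hraise Δ hΔ0 le_rfl (h31.trans (min_le_left _ _))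
      (h31.trans (min_le_right _ _))
    rw [← EReal.coe_add]
    refine Runs.tick (Runs.bind (applyDuals_runs hdel' hc') ?_)
    rintro ⟨L1, R1, Φ1, Ψ1, jl⟩ u ⟨rfl, rfl, rfl, hΦ', hΨ', hu⟩
    dsimp only at hΦ' hΨ'
    have hφk : φ' k = lam := by
      rw [e1 k hak.le le_rfl, hΔ, h32]
      ring
    refine Runs.pure ⟨⟨⟨φ', ψ', hc'.finish_unassigned hφk,
      fun i hi => hΦ' i (Fin.le_def.2 (by omega)), hΨ'⟩, hinv, fun i j hi => ?_, Or.inr ?_⟩,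
      by omega⟩
    · dsimp only
      rw [hjs]
      exact hc.last i j hi
    · obtain ⟨i, -, -, hi⟩ := hc.source hc.le le_rfl
      exact ⟨i, by dsimp only; rw [hjs]; exact hi⟩
  · obtain ⟨φ', ψ', hc', hdel', e1, -, -⟩ := hraise Δ hΔ0 le_rfl (h31.trans (min_le_left _ _))
      (h31.trans (min_le_right _ _))
    rw [← EReal.coe_add]
    refine Runs.tick (Runs.bind (applyDuals_runs hdel' hc') ?_)
    rintro ⟨L1, R1, Φ1, Ψ1, jl⟩ u ⟨rfl, rfl, rfl, hΦ', hΨ', hu⟩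
    have hek' := lt_of_le_of_ne hek h32
    have hφe : φ' e = lam := by
      rw [e1 e hae hek, hΔ]
      ring
    refine Runs.unassign (shift_runs hc' hae hinv hΦ' hΨ' hjs
      (fun i h1 _ => Function.update_of_ne h1.ne' _ _)
      (fun L' hL' => hc'.finish_drop hae hek' hφe hL') (fun L' _ _ i j _ h1 _ => ?_)
      (fun _ _ _ _ => rfl) fun s' u' h1 h2 => ⟨h1, by omega⟩)
    dsimp only at h1
    by_cases hie : i = e
    · rw [hie, Function.update_self] at h1
      simp at h1
    · rw [Function.update_of_ne hie] at h1
      exact (hinv i j).1 h1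
  · obtain ⟨j, hj⟩ : ∃ j, next? js = some j := by
      rcases not_le.1 h31 |> min_lt_iff.1 with h4 | h4
      · exact α2 _ h4
      · exact α2 _ ((h33.trans (min_le_right _ _)).trans_lt h4)
    have hj' : j.val = js.val + 1 := by
      rcases next?_cases js with h4 | ⟨j', h4, h5⟩
      · rw [h4.1] at hj; simp at hj
      · rw [hj] at h4
        rwa [Option.some_inj.1 h4]
    have hαj := hα j hj'
    have hjs' : js < j := by rw [Fin.lt_def]; omega
    rw [hαj] at h33
    obtain ⟨φ', ψ', hc', hdel', e1, e2, -⟩ := hraise (c (x k) (y j) - φ k - ψ j)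
      (by linarith [hc.feas k j le_rfl]) (EReal.coe_le_coe_iff.1 (h33.trans (min_le_left _ _)))
      hαj.ge (h33.trans (min_le_right _ _))
    rw [hαj, ← EReal.coe_add]
    refine Runs.tick (Runs.bind (applyDuals_runs hdel' hc') ?_)
    rintro ⟨L1, R1, Φ1, Ψ1, jl⟩ u ⟨rfl, rfl, rfl, hΦ', hΨ', hu⟩
    have hfin := hc'.finish_right hjs' (by
      rw [e1 k hak.le le_rfl, e2 j (Or.inr hjs')]
      ring)
    refine Runs.need hj (Runs.assign (Runs.tick (Runs.pure ⟨FullInv.of_last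
      ⟨φ', ψ', hfin, fun i hi => hΦ' i (Fin.le_def.2 (by omega)), hΨ'⟩
      (isInverse_update hinv hfin.adm (fun i l hi _ => ⟨i, (hc.dom i l hi).ne, hi⟩)
        fun _ _ h => h) ?_, by omega⟩)))
    exact Function.update_self _ _ _
  · have hβα : β < α ∧ β < (Δ : EReal) := by
      rw [not_le] at h31 h33
      rcases min_lt_iff.1 h31 with h4 | h4 <;> rcases min_lt_iff.1 h33 with h5 | h5
      · exact absurd h4 (not_lt.2 h5.le)
      · exact ⟨h5, h5.trans h4⟩
      · exact ⟨h4.trans h5, h4⟩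
      · exact ⟨h5, h4⟩
    obtain ⟨j, hj⟩ := β2 _ hβα.1
    have hj' : j.val + 1 = b.val := by
      rcases prev?_cases b with h4 | ⟨j', h4, h5⟩
      · rw [h4.1] at hj; simp at hj
      · rw [hj] at h4
        rwa [Option.some_inj.1 h4]
    have hβj := hβ j hj'
    rw [hβj] at hβα
    have hlt : c (x a) (y j) - φ a - ψ j < Δ := EReal.coe_lt_coe_iff.1 hβα.2
    have hjb : j < b := by rw [Fin.lt_def]; omega
    obtain ⟨φ', ψ', hc', hdel', e1, e2, e3⟩ := hraise (c (x a) (y j) - φ a - ψ j)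
      (by linarith [hc.feas a j hak.le]) hlt.le hβα.1.le hβj.ge
    rw [hβj]
    have ht : φ' a + ψ' j = c (x a) (y j) := by
      rw [e1 a le_rfl hak.le, e2 j (Or.inl hjb)]
      ring
    have hφa : φ' a < lam := by
      rw [e1 a le_rfl hak.le]
      linarith [hmin a le_rfl hak.le]
    generalize c (x a) (y j) - φ a - ψ j = δ at *
    rw [← EReal.coe_add]
    -- the final part of the two cases in which `j` is taken over by the first point of the chain
    have left : ∀ (L₁ : Fin n → Option (Fin m)) (Φ' : Fin n → EReal) (Ψ' : Fin m → EReal) (t : ℕ),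
        t ≤ 3 * n + 9 → (∀ i, i ≤ k → Φ' i = (φ' i : EReal)) → (∀ j, Ψ' j = (ψ' j : EReal)) →
        (∀ i, i < a → L₁ i ≠ some j ∧
          (L₁ i = s.L i ∨ (L₁ i = none ∧ φ' i = lam ∧ s.L i = some j))) →
        (∀ i, a < i → L₁ i = s.L i) →
        Runs (assign a j { s with L := L₁, Φ := Φ', Ψ := Ψ' } >>= fun s => assign k js s >>=
          fun s => shiftDownFull (between a k) s >>= fun s =>
            pure (Sum.inr s : ChainVars n m ⊕ FullVars n m)) fun r u =>
          r.elim (fun w' => (∃ v d φ ψ, ChainInv c x y lam k js s w' v d φ ψ) ∧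
            w'.imin.val < a.val ∧ t + u ≤ 12)
          fun s' => FullInv c x y lam (k + 1) s' ∧ t + u ≤ 6 * n + 30 := by
      intro L₁ Φ' Ψ' t ht' hΦ' hΨ' hL₁ hL₁'
      have hLa : ∀ L', IsShift (between a k)
          (Function.update (Function.update L₁ a (some j)) k (some js)) L' → L' a = some j := by
        intro L' hL'
        rw [hL'.2 a fun h' => absurd (mem_between.1 h').1 (lt_irrefl _),
          Function.update_of_ne hak.ne, Function.update_self]
      refine Runs.assign (shift_runs hc' le_rfl hinv hΦ' hΨ' hjs
        (fun i h1 _ => (Function.update_of_ne h1.ne' _ _).trans (hL₁' i h1))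
        (fun L' hL' => hc'.finish_left hj' ht hL₁ hL₁' hL') (fun L' hL' hadm i l _ h1 h2 => ?_)
        (fun L' hL' l hl => ?_) fun s' u' h1 h2 => ⟨h1, by omega⟩)
      · dsimp only at h1 ⊢
        by_cases hia : i = a
        · subst hia
          rw [Function.update_self] at h1
          obtain rfl := Option.some_inj.1 h1
          exact Function.update_self _ _ _
        · rw [Function.update_of_ne]
          · rw [Function.update_of_ne hia] at h1
            rw [← hinv i l]
            rcases lt_or_gt_of_ne hia with h3 | h3
            · rcases (hL₁ i h3).2 with h4 | h4
              · rw [← h4]; exact h1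
              · rw [h4.1] at h1; simp at h1
            · rw [← hL₁' i h3]; exact h1
          · rintro rfl
            exact hia (hadm.injOn h2 (hLa L' hL'))
      · dsimp only
        rw [Function.update_of_ne]
        rintro rfl
        exact hl a (hLa L' hL')
    refine Runs.tick (Runs.need hj ?_)
    split
    · rename_i hnone
      have hfree : ∀ i, s.L i ≠ some j := fun i hi => by
        rw [hinv, hnone] at hi
        simp at hi
      refine Runs.bind (applyDuals_runs hdel' hc') ?_
      rintro ⟨L1, R1, Φ1, Ψ1, jl⟩ u ⟨rfl, rfl, rfl, hΦ', hΨ', hu⟩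
      refine (left s.L Φ1 Ψ1 (4 + (1 + u)) (by omega) hΦ' hΨ' (fun i _ => ⟨hfree i, Or.inl rfl⟩)
        fun _ _ => rfl).mono fun r u' hr => ?_
      simpa only [add_assoc] using hr
    · rename_i i hi
      have hi : s.L i = some j := (hinv i j).2 hi
      obtain ⟨g1, g2⟩ := hc'.gap hC hj' hi ht hφa
      have hia : i < a := g1
      split_ifs with hgt
      · refine Runs.bind (applyDuals_runs hdel' hc') ?_
        rintro ⟨L1, R1, Φ1, Ψ1, jl⟩ u ⟨rfl, rfl, rfl, hΦ', hΨ', hu⟩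
        refine Runs.unassign ?_
        refine (left (Function.update s.L i none) Φ1 Ψ1 (4 + (1 + (u + 1))) (by omega) hΦ' hΨ'
          (fun l hl => ?_) fun l hl => ?_).mono fun r u' hr => ?_
        · by_cases hli : l = i
          · subst hli
            rw [Function.update_self]
            exact ⟨by simp, Or.inr ⟨rfl, (g2 hgt).1, hi⟩⟩
          · rw [Function.update_of_ne hli]
            exact ⟨fun h' => hli (hc.adm.injOn h' hi), Or.inl rfl⟩
        · exact Function.update_of_ne (hia.trans hl).ne' _ _
        · simpa only [add_assoc] using hr
      · have hsucc : i.val + 1 = a.val := by omega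
        refine Runs.need (prev?_of_succ hsucc) (Runs.tick ?_)
        have hch := hc'.extend hsucc hj' hi ht
        have hde := hdel'.extend hc.adm hsucc hi
        have hdi : Function.update (fun i => (d i : EReal)) i ((v + δ : ℝ) : EReal)
            = fun l => ((Function.update d i (v + δ) l : ℝ) : EReal) := by
          funext l
          by_cases hli : l = i
          · subst hli; simp
          · simp [hli]
        -- The raise did not touch the point before the chain, so its gap can be read off the stored
        -- array.
        have hΦi : s.Φ i = (φ' i : EReal) := by rw [hdel.Φ_lt i hia, e3 i hia]
        have hor : ∀ l, i ≤ l → l = i ∨ a ≤ l := fun l hl => by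
          rw [Fin.le_def] at hl
          rcases eq_or_lt_of_le hl with h1 | h1
          · exact Or.inl (Fin.ext h1.symm)
          · exact Or.inr (by rw [Fin.le_def]; omega)
        -- All gaps in the old chain shrink by the same `δ`, so the old minimiser stays minimal
        -- among them and only the new point has to be compared.
        have hφe := e1 e hae hek
        rw [hΦi, ← EReal.coe_sub, ← EReal.coe_sub, hdi]
        split_ifs with hlt'
        · have hlt' := EReal.coe_lt_coe_iff.1 hlt'
          refine Runs.tick (Runs.pure ⟨⟨v + δ, _, φ', ψ', hch, hde, rfl, rfl,
            Function.update_self _ _ _, le_rfl, (hia.trans hak).le, rfl, fun l h1 h2 => ?_⟩, hia,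
            by omega⟩)
          rcases hor l h1 with rfl | h3
          · exact le_rfl
          · dsimp only
            linarith [e1 l h3 h2, hmin l h3 h2]
        · rw [EReal.coe_lt_coe_iff, not_lt] at hlt'
          refine Runs.pure ⟨⟨v + δ, _, φ', ψ', hch, hde, rfl, rfl,
            Function.update_self _ _ _, hia.le.trans hae, hek, ?_, fun l h1 h2 => ?_⟩, hia,
            by omega⟩
          · dsimp only
            rw [hφe, hΔ]
            congr 1
            ring
          · dsimp only
            rcases hor l h1 with rfl | h3
            · linarith
            · linarith [e1 l h3 h2, hmin l h3 h2]

theorem subOptFull_runs (A : ArgminRule) (hC : SortedCost (fun i j => c (x i) (y j)) true)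
    {k a : Fin n} {js : Fin m} {s : FullVars n m} (hinv : IsInverse s.L s.R) (hjs : s.jlast = js)
    (hak : a.val + 1 = k.val) {φ : Fin n → ℝ} {ψ : Fin m → ℝ}
    (hc : Chain (fun i j => c (x i) (y j)) lam k js a js s.L φ ψ)
    (hΦ : ∀ i, i ≤ k → s.Φ i = (φ i : EReal)) (hΨ : ∀ j, s.Ψ j = (ψ j : EReal)) :
    Runs (subOptFull A c x y lam k js s) fun s' u =>
      FullInv c x y lam (k + 1) s' ∧ u ≤ 19 * n + 40 := by
  unfold subOptFull
  refine Runs.need (prev?_of_succ hak) (Runs.tick (Runs.argmin ⟨a, by simp⟩ fun e he hmin =>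
    Runs.tick ?_))
  have hcard : ({a, k} : Finset (Fin n)).card ≤ 2 := Finset.card_le_two
  have hlt : a < k := hc.lt
  have hek : a ≤ e ∧ e ≤ k := by
    rcases Finset.mem_insert.1 he with rfl | h1
    · exact ⟨le_rfl, hlt.le⟩
    · rw [Finset.mem_singleton] at h1
      rw [h1]
      exact ⟨hlt.le, le_rfl⟩
  have hgap : ∀ i, i ≤ k → (lam : EReal) - s.Φ i = ((lam - φ i : ℝ) : EReal) := fun i hi => by
    rw [hΦ i hi, EReal.coe_sub]
  -- Each repeating pass lowers `imin` and costs at most 12 steps, so `u + 12 * imin` never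
  -- increases and stays below `12 * n`; the returning pass adds `6 * n + 30`.
  refine (Runs.loop (Q := fun s' u => FullInv c x y lam (k + 1) s' ∧ u ≤ 18 * n + 30)
    (fun w u => (∃ v d φ ψ, ChainInv c x y lam k js s w v d φ ψ) ∧
      u + 12 * w.imin.val ≤ 12 * n) (fun w => w.imin.val) ?_ ⟨⟨0, fun _ => 0, φ, ψ, ?_⟩, ?_⟩).mono ?_
  · rintro w u ⟨hw, hu⟩
    refine (subOptFullBody_runs hC hinv hjs hw).mono ?_
    rintro (w' | s') u' hr
    · obtain ⟨h1, h2, h3⟩ := hr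
      exact ⟨⟨h1, by omega⟩, h2⟩
    · exact ⟨hr.1, by have := hr.2; omega⟩
  · refine ⟨hc, ⟨fun i hi => hΦ i (hi.trans hlt).le, fun i _ hi => ?_, ?_, fun i j _ _ _ => ?_,
      fun j _ => hΨ j⟩, rfl, rfl, rfl, hek.1, hek.2, hgap e hek.2, fun i h1 h2 => ?_⟩
    · rw [hΦ i hi.le]; simp
    · rw [hΦ k le_rfl]; simp
    · rw [hΨ j]; simp
    · have hi : i ∈ ({a, k} : Finset (Fin n)) := by
        rw [Finset.mem_insert, Finset.mem_singleton, Fin.ext_iff, Fin.ext_iff]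
        have h1 : a.val ≤ i.val := h1
        have h2 : i.val ≤ k.val := h2
        omega
      have := hmin i hi
      rw [hgap e hek.2, hgap i h2, EReal.coe_le_coe_iff] at this
      dsimp only
      linarith
  · have := a.2
    dsimp only
    omega
  · rintro s' u ⟨h1, h2⟩
    exact ⟨h1, by omega⟩

theorem opt1dFullStep_runs (A : ArgminRule) (hC : SortedCost (fun i j => c (x i) (y j)) true)
    {k : Fin n} {s : FullVars n m} (h : FullInv c x y lam k s) :
    Runs (opt1dFullStep A c x y lam s k) fun s' u =>
      FullInv c x y lam (k + 1) s' ∧ u ≤ m + 19 * n + 50 := by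
  obtain ⟨⟨φ, ψ, hi, hΦ, hΨ⟩, hinv, hle_last, hlast'⟩ := h
  unfold opt1dFullStep
  refine Runs.tick (Runs.argmin ⟨s.jlast, Finset.mem_Ici.2 le_rfl⟩ fun js hjs hmin => ?_)
  have hcard : (Finset.Ici s.jlast).card ≤ m :=
    (Finset.card_le_univ _).trans (Fintype.card_fin m).le
  dsimp only
  -- The indices before `jlast` are dominated by `jlast` if it is assigned; otherwise it is the
  -- first index and nothing is excluded.
  obtain ⟨φ', hi', e1, hΦ', hf, hle, ht, -⟩ := hi.select hC hΦ hΨ hmin (fun j hj => by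
    rw [Finset.mem_Ici, not_le] at hj
    rcases hlast' with h1 | ⟨i, h1⟩
    · rw [Fin.lt_def] at hj
      omega
    · exact ⟨i, s.jlast, h1, hj.le, Finset.mem_Ici.2 le_rfl⟩)
  have hjs := Finset.mem_Ici.1 hjs
  have hlast : ∀ i j, s.L i = some j → j ≤ js := fun i j h1 => (hle_last i j h1).trans hjs
  refine Runs.tick ?_
  split_ifs with h1
  · rw [e1] at h1
    exact Runs.pure ⟨⟨⟨φ', ψ, hi'.step_unassigned (EReal.coe_eq_coe_iff.1 h1) hf, hΦ', hΨ⟩, hinv,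
      hle_last, hlast'⟩, by omega⟩
  · rw [e1, EReal.coe_eq_coe_iff] at h1
    have ht := ht h1
    refine Runs.tick ?_
    split
    · rename_i hnone
      have hfree : ∀ i, s.L i ≠ some js := fun i h2 => by
        rw [hinv, hnone] at h2
        simp at h2
      have hfin := hi'.step_free hle hf ht hlast hfree
      refine Runs.assign (Runs.tick (Runs.pure ⟨FullInv.of_last ⟨φ', ψ, hfin, hΦ', hΨ⟩
        (isInverse_update hinv hfin.adm (fun i j h2 _ => ⟨i, Fin.ne_of_lt (hi.dom i j h2), h2⟩)
          fun _ _ h => h) (Function.update_self _ _ _), by omega⟩))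
    · rename_i i hias
      have hias : s.L i = some js := (hinv i js).2 hias
      -- A candidate that is already assigned can only be the last assigned target.
      have hjl : s.jlast = js := le_antisymm hjs (hle_last i js hias)
      obtain ⟨g1, g2⟩ := hi'.gap hC hlast hias ht (lt_of_le_of_ne hle h1)
      refine Runs.tick ?_
      split_ifs with hgt
      · have hfin := hi'.step_swap hle hf ht hlast hias (g2 hgt).1
        refine Runs.unassign ?_
        refine Runs.tick (Runs.pure ⟨FullInv.of_last ⟨φ', ψ, hfin, hΦ', hΨ⟩
          (isInverse_swap hinv hfin.adm (fun l j h2 => Fin.ne_of_lt (hi.dom l j h2)) hias)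
          ((Function.update_self _ _ _).trans (congrArg some hjl.symm)), by omega⟩)
      · have hsucc : i.val + 1 = k.val := by omega
        have hch := hi'.chain hle hf ht hlast hias hsucc.symm
        refine (subOptFull_runs (s := { s with
          Φ := Function.update s.Φ k (min ((c (x k) (y js) : EReal) - s.Ψ js) lam) })
          A hC hinv hjl hsucc hch
          (fun l hl => hΦ' l (Nat.lt_succ_of_le hl)) hΨ).mono ?_
        rintro s' u ⟨h2, h3⟩
        exact ⟨h2, by omega⟩

theorem opt1dFull_correct (hm : 0 < m) (A : ArgminRule)
    (hC : SortedCost (fun i j => c (x i) (y j)) true) :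
    Runs (opt1dFull A c x y lam) fun out u =>
      IsOptimalOutput c x y lam out.L out.Φ out.Ψ ∧
        u ≤ 2 * n + 2 * m + 1 + n * (m + 19 * n + 50) := by
  unfold opt1dFull
  refine Runs.tick (Runs.need (a := ⟨0, hm⟩) (by rw [dif_pos hm]) ?_)
  refine (Runs.foldlM_finRange
    (fun k s u => FullInv c x y lam k s ∧ u ≤ k * (m + 19 * n + 50))
    (fun k s u hs => (opt1dFullStep_runs A hC hs.1).mono fun s' u' hs' => ⟨hs'.1, ?_⟩)
    ⟨⟨⟨fun _ => 0, fun _ => lam, inv_zero, ?_, fun _ => rfl⟩, ?_, ?_, Or.inl rfl⟩, ?_⟩).mono ?_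
  · have h1 := hs.2
    have h2 := hs'.2
    rw [add_mul, one_mul]
    omega
  · intro i hi; simp at hi
  · intro i j; simp
  · intro i j hi; simp at hi
  · simp
  · rintro s u ⟨⟨⟨φ, ψ, h1, h2, h3⟩, -, -, -⟩, hu⟩
    exact ⟨isOptimalOutput_of_inv h1 (fun i => h2 i i.2) h3, by omega⟩

end Refined

end OPT1D

theorem mainTheorem6 :
    -- correctness of the algorithm: for sorted lists with the handling of duplicates,
    -- for strictly sorted lists also without
    (∀ (n m : ℕ), 0 < m → ∀ (h : ℝ → ℝ), StrictConvexOn ℝ Set.univ h → ∀ (lam : ℝ), 0 ≤ lam →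
      ∀ (x : Fin n → ℝ) (y : Fin m → ℝ), Monotone x → Monotone y →
      ∀ (A : OPT1D.ArgminRule) (dup : Bool), dup = true ∨ (StrictMono x ∧ StrictMono y) →
      ∃ (out : OPT1D.Vars n m) (t : ℕ),
        (OPT1D.opt1d A dup (fun a b => h (a - b)) x y lam).run 0 = some (out, t) ∧
        OPT1D.IsOptimalOutput (fun a b => h (a - b)) x y lam out.L out.Φ out.Ψ) ∧
    -- correctness and worst-case running time of the refined version
    (∃ C : ℕ, ∀ (n m : ℕ), 0 < m → ∀ (h : ℝ → ℝ), StrictConvexOn ℝ Set.univ h →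
      ∀ (lam : ℝ), 0 ≤ lam →
      ∀ (x : Fin n → ℝ) (y : Fin m → ℝ), Monotone x → Monotone y →
      ∀ (A : OPT1D.ArgminRule),
      ∃ (out : OPT1D.FullVars n m) (t : ℕ),
        (OPT1D.opt1dFull A (fun a b => h (a - b)) x y lam).run 0 = some (out, t) ∧
        OPT1D.IsOptimalOutput (fun a b => h (a - b)) x y lam out.L out.Φ out.Ψ ∧
        (0 < n → t ≤ C * (n * max m n))) := by
  -- With `M = max m n ≥ 1`, initialisation takes at most `5 * M ≤ 5 * (n * M)` steps and the
  -- iterations at most `70 * (n * M)`; 80 leaves some room.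
  refine ⟨?_, 80, ?_⟩
  · intro n m hm h hh lam _ x y hx hy A dup hdup
    obtain ⟨out, u, h1, h2⟩ := OPT1D.opt1d_correct (lam := lam) (c := fun a b => h (a - b)) hm A
      (OPT1D.sortedCost_of_strictConvexOn hh hx hy hdup) 0
    exact ⟨out, _, h1, h2⟩
  · intro n m hm h hh lam _ x y hx hy A
    obtain ⟨out, u, h1, h2, h3⟩ := OPT1D.opt1dFull_correct (lam := lam)
      (c := fun a b => h (a - b)) hm A
      (OPT1D.sortedCost_of_strictConvexOn hh hx hy (Or.inl rfl)) 0
    refine ⟨out, _, h1, h2, fun hn => ?_⟩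
    have hm' : m ≤ max m n := le_max_left _ _
    have hn' : n ≤ max m n := le_max_right _ _
    generalize max m n = M at *
    have k1 : n * (m + 19 * n + 50) ≤ n * (70 * M) := Nat.mul_le_mul_left n (by omega)
    have k2 : M ≤ n * M := Nat.le_mul_of_pos_left M hn
    have k3 : n * (70 * M) = 70 * (n * M) := by ring
    omega
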